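/- Let $p:Y\to X$ be a strong M-polyfold bundle over an M-polyfold $X$, let $q\in X_\infty$ be a smooth point, and let $[f,q]$ be the germ at $q$ of an sc-smooth section $f$ of $p$. For every germ $[s]$ at $q$ of an $\mathrm{sc}^+$-section of $p$ with $s(q)=f(q)$, the section $f-s$ vanishes at $q$, and the linearization of $[f,q]$ with respect to $[s]$ is the linear operator $$f'_{[s]}(q):=P_q\circ T(f-s)(q):T_qX\to Y_q=p^{-1}(q),$$ where $P_q:T_{0_q}Y\cong T_qX\oplus Y_q\to Y_q$ is the projection. In a strong bundle chart $\Phi:p^{-1}(U)\to K^{\mathcal R}$ covering $\varphi:U\to O$, with $q\in U$, it is $\delta w\mapsto D{\bf g}(\varphi(q))\,\delta w$, where ${\bf g}$ is the principal part of $f-s$ in the chart. The space $T_qX$ and the fiber $Y_q$ carry the sc-structures induced by such a chart. Then: 1. For every such germ $[s]$ there is a unique linear operator $f'_{[s]}(q):T_qX\to Y_q$ which has this form in all strong bundle charts around $q$. 2. For any two germs $[s],[t]$ of $\mathrm{sc}^+$-sections with $s(q)=t(q)=f(q)$, the difference $f'_{[s]}(q)-f'_{[t]}(q)$ is an $\mathrm{sc}^+$-operator: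 it is an sc-operator $T_qX\to Y_q$ which also induces bounded operators $(T_qX)_m\to (Y_q)_{m+1}$ for all $m\ge 0$. 3. If $f'_{[s]}(q)$ is sc-Fredholm for one such germ $[s]$, then $f'_{[t]}(q)$ is sc-Fredholm for every such germ $[t]$, and $$\dim\ker f'_{[t]}(q)-\dim\operatorname{coker} f'_{[t]}(q)=\dim\ker f'_{[s]}(q)-\dim\operatorname{coker} f'_{[s]}(q).$$ Hence the index $\operatorname{Ind}(f,q):=i(f'_{[s]}(q))$ does not depend on $[s]$. -/

import Mathlib

open Set Filter Topology

universe u v w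

/-! ## Scales and sc-Banach spaces -/

/-- A sequence of subspaces `level m` of a vector space together with a function `nrm m`, whose
values on `level m` are the ones that matter: there it plays the role of the norm of `level m`. -/
structure Scale (V : Type*) [AddCommGroup V] [Module ℝ V] where
  level : ℕ → Submodule ℝ V
  nrm : ℕ → V → ℝ

namespace Scale

variable {V : Type*} [AddCommGroup V] [Module ℝ V] {V₂ : Type*} [AddCommGroup V₂] [Module ℝ V₂]

/-- The smooth points: the intersection of all levels. -/
def inf (S : Scale V) : Submodule ℝ V := ⨅ m, S.level m

/-- The scale `E^k`, whose level `m` is the level `m + k` of `E`. -/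
def shift (S : Scale V) (k : ℕ) : Scale V :=
  ⟨fun m => S.level (m + k), fun m => S.nrm (m + k)⟩

/-- The scale of `E ⊕ F`. -/
def prod (S : Scale V) (S₂ : Scale V₂) : Scale (V × V₂) :=
  ⟨fun m => (S.level m).prod (S₂.level m), fun m x => max (S.nrm m x.1) (S₂.nrm m x.2)⟩

/-- The scale of the tangent `TE = E^1 ⊕ E`. -/
def tangent (S : Scale V) : Scale (V × V) := (S.shift 1).prod S

/-- The scale pulled back along a linear map. -/
def comap (e : V →ₗ[ℝ] V₂) (S₂ : Scale V₂) : Scale V :=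
  ⟨fun m => (S₂.level m).comap e, fun m x => S₂.nrm m (e x)⟩

/-- The induced scale `F_m = F ∩ E_m` of a subspace. -/
def restrict (S : Scale V) (F : Submodule ℝ V) : Scale F := S.comap F.subtype

/-- The scale is an sc-structure on `V = E_0`: a nested sequence of Banach spaces, with compact
inclusions, such that the intersection of all levels is dense in every level. -/
structure IsSc (S : Scale V) : Prop where
  level_zero : S.level 0 = ⊤
  nested : ∀ m, S.level (m + 1) ≤ S.level m
  nrm_add : ∀ m, ∀ x ∈ S.level m, ∀ y ∈ S.level m, S.nrm m (x + y) ≤ S.nrm m x + S.nrm m y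
  nrm_smul : ∀ m, ∀ a : ℝ, ∀ x ∈ S.level m, S.nrm m (a • x) = |a| * S.nrm m x
  eq_zero_of_nrm : ∀ m, ∀ x ∈ S.level m, S.nrm m x = 0 → x = 0
  complete : ∀ m, ∀ a : ℕ → V, (∀ i, a i ∈ S.level m) →
    (∀ ε > 0, ∃ N, ∀ i ≥ N, ∀ j ≥ N, S.nrm m (a i - a j) < ε) →
    ∃ x ∈ S.level m, Tendsto (fun i => S.nrm m (a i - x)) atTop (𝓝 0)
  compact : ∀ m n, m < n → ∀ a : ℕ → V, (∀ i, a i ∈ S.level n ∧ S.nrm n (a i) ≤ 1) →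
    ∃ x ∈ S.level m, ∃ σ : ℕ → ℕ, StrictMono σ ∧
      Tendsto (fun i => S.nrm m (a (σ i) - x)) atTop (𝓝 0)
  dense : ∀ m, ∀ x ∈ S.level m, ∀ ε > 0, ∃ y ∈ S.inf, S.nrm m (x - y) < ε

/-! ### Linear sc-theory -/

/-- A linear map which induces bounded operators on all levels. -/
def IsScOperator (S : Scale V) (S₂ : Scale V₂) (T : V →ₗ[ℝ] V₂) : Prop :=
  ∀ m, ∃ K : ℝ, ∀ x ∈ S.level m, T x ∈ S₂.level m ∧ S₂.nrm m (T x) ≤ K * S.nrm m x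

/-- An sc⁺-operator: an sc-operator which induces an sc-operator `E → F^1`. -/
def IsScPlusOperator (S : Scale V) (S₂ : Scale V₂) (T : V →ₗ[ℝ] V₂) : Prop :=
  S.IsScOperator S₂ T ∧ S.IsScOperator (S₂.shift 1) T

/-- A closed subspace on which `F ∩ E_m` is an sc-structure. -/
def IsScSubspace (S : Scale V) (F : Submodule ℝ V) : Prop :=
  (∀ x ∈ S.level 0, (∀ ε > 0, ∃ y ∈ F, S.nrm 0 (x - y) < ε) → x ∈ F) ∧ (S.restrict F).IsSc

/-- The sc-splitting `E = F ⊕ G`: topological direct sums `E_m = F_m ⊕ G_m` on all levels. -/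
structure IsScSplitting (S : Scale V) (F G : Submodule ℝ V) : Prop where
  left : S.IsScSubspace F
  right : S.IsScSubspace G
  disjoint : F ⊓ G = ⊥
  sum : ∀ m, S.level m = (F ⊓ S.level m) ⊔ (G ⊓ S.level m)
  bounded : ∀ m, ∃ K : ℝ, ∀ x ∈ F ⊓ S.level m, ∀ y ∈ G ⊓ S.level m,
    S.nrm m x ≤ K * S.nrm m (x + y) ∧ S.nrm m y ≤ K * S.nrm m (x + y)

/-- The sc-operator `T` is sc-Fredholm: there are sc-splittings `E = ker T ⊕ X` and `F = Y ⊕ C`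
with `ker T` and `C` of finite dimension, such that `T : X → Y` is a linear sc-isomorphism. -/
def IsScFredholm (S : Scale V) (S₂ : Scale V₂) (T : V →ₗ[ℝ] V₂) : Prop :=
  S.IsScOperator S₂ T ∧
  ∃ (X : Submodule ℝ V) (Y C : Submodule ℝ V₂),
    S.IsScSplitting (LinearMap.ker T) X ∧ S₂.IsScSplitting Y C ∧
    FiniteDimensional ℝ (LinearMap.ker T) ∧ FiniteDimensional ℝ C ∧
    ∃ e : X ≃ₗ[ℝ] Y, (∀ x : X, (e x : V₂) = T x) ∧
      (S.restrict X).IsScOperator (S₂.restrict Y) (e : X →ₗ[ℝ] Y) ∧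
      (S₂.restrict Y).IsScOperator (S.restrict X) (e.symm : Y →ₗ[ℝ] X)

end Scale

/-- The Fredholm index `dim ker T - dim coker T`. -/
noncomputable def fredholmIndex {V V₂ : Type*} [AddCommGroup V] [Module ℝ V] [AddCommGroup V₂]
    [Module ℝ V₂] (T : V →ₗ[ℝ] V₂) : ℤ :=
  (Module.finrank ℝ (LinearMap.ker T) : ℤ) - (Module.finrank ℝ (V₂ ⧸ LinearMap.range T) : ℤ)

/-- An sc-Banach space: a Banach space `E` with an sc-structure, `E = E_0`. -/
structure ScBanach : Type (u + 1) where
  carrier : Type u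
  [normedAddCommGroup : NormedAddCommGroup carrier]
  [normedSpace : NormedSpace ℝ carrier]
  [completeSpace : CompleteSpace carrier]
  scale : Scale carrier
  isSc : scale.IsSc
  nrm_zero : ∀ x, scale.nrm 0 x = ‖x‖

instance : CoeSort ScBanach (Type u) := ⟨ScBanach.carrier⟩

attribute [instance] ScBanach.normedAddCommGroup ScBanach.normedSpace ScBanach.completeSpace

/-! ## Sc-smooth maps

Below `D` is the domain of a map; the values of the map outside of `D` are irrelevant. -/

section ScSmooth

variable {V : Type*} [AddCommGroup V] [Module ℝ V] {V₂ : Type*} [AddCommGroup V₂] [Module ℝ V₂]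

/-- `f` maps `D_m` to level `m`, continuously, for every `m`. -/
def IsScZero (S : Scale V) (S₂ : Scale V₂) (D : Set V) (f : V → V₂) : Prop :=
  ∀ m, ∀ x ∈ D, x ∈ S.level m → f x ∈ S₂.level m ∧
    ∀ ε > 0, ∃ δ > 0, ∀ y ∈ D, y ∈ S.level m → S.nrm m (y - x) < δ → S₂.nrm m (f y - f x) < ε

/-- `A` restricts to a bounded operator `E_0 → F_0`, and
`‖f (x + h) - f x - A h‖₀ / ‖h‖₁ → 0` as `‖h‖₁ → 0`, where `h ∈ E_1` and `x + h ∈ D`. -/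
def HasScDerivAt (S : Scale V) (S₂ : Scale V₂) (D : Set V) (f : V → V₂) (x : V)
    (A : V →ₗ[ℝ] V₂) : Prop :=
  (∃ K : ℝ, ∀ h ∈ S.level 0, A h ∈ S₂.level 0 ∧ S₂.nrm 0 (A h) ≤ K * S.nrm 0 h) ∧
  ∀ ε > 0, ∃ δ > 0, ∀ h ∈ S.level 1, x + h ∈ D → S.nrm 1 h < δ →
    S₂.nrm 0 (f (x + h) - f x - A h) ≤ ε * S.nrm 1 h

open Classical in
/-- The linearization `Df(x)`, with value `0` if there is none. -/
noncomputable def scDeriv (S : Scale V) (S₂ : Scale V₂) (D : Set V) (f : V → V₂) (x : V) :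
    V →ₗ[ℝ] V₂ :=
  if h : ∃ A, HasScDerivAt S S₂ D f x A then h.choose else 0

/-- The domain `TD = D_1 ⊕ E_0` of the tangent map. -/
def tangentDomain (S : Scale V) (D : Set V) : Set (V × V) :=
  {p | p.1 ∈ D ∧ p.1 ∈ S.level 1 ∧ p.2 ∈ S.level 0}

end ScSmooth

/-- Maps of class sc^k: `f` is of class sc^(k+1) if it is sc^0, has a linearization at the points
of `D_1`, and its tangent map `Tf (x, h) = (f x, Df(x) h)` on `TD` is of class sc^k. -/
def IsScClass : ℕ → ∀ {V : Type v} {V₂ : Type w} [AddCommGroup V] [Module ℝ V]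
    [AddCommGroup V₂] [Module ℝ V₂], Scale V → Scale V₂ → Set V → (V → V₂) → Prop
  | 0, _, _, _, _, _, _, S, S₂, D, f => IsScZero S S₂ D f
  | k + 1, V, V₂, _, _, _, _, S, S₂, D, f =>
      IsScZero S S₂ D f ∧ ∃ Df : V → V →ₗ[ℝ] V₂,
        (∀ x ∈ D, x ∈ S.level 1 → HasScDerivAt S S₂ D f x (Df x)) ∧
        IsScClass k S.tangent S₂.tangent (tangentDomain S D) (fun p => (f p.1, Df p.1 p.2))

/-- Sc-smooth maps. -/
def IsScSmooth {V : Type v} {V₂ : Type w} [AddCommGroup V] [Module ℝ V] [AddCommGroup V₂]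
    [Module ℝ V₂] (S : Scale V) (S₂ : Scale V₂) (D : Set V) (f : V → V₂) : Prop :=
  ∀ k, IsScClass k S S₂ D f

/-! ## Splicings and local M-polyfold models -/

/-- `C ⊆ W` is a partial quadrant: a linear sc-isomorphism `W → ℝⁿ ⊕ Q` maps it onto
`[0, ∞)ⁿ ⊕ Q`. -/
def IsPartialQuadrant (W : ScBanach.{u}) (C : Set W) : Prop :=
  ∃ (n : ℕ) (Q : ScBanach.{u}) (T : W ≃ₗ[ℝ] (Fin n → ℝ) × Q),
    W.scale.IsScOperator (Scale.prod ⟨fun _ => ⊤, fun _ x => ‖x‖⟩ Q.scale) T.toLinearMap ∧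
    Scale.IsScOperator (Scale.prod ⟨fun _ => ⊤, fun _ x => ‖x‖⟩ Q.scale) W.scale
      T.symm.toLinearMap ∧
    T '' C = {p | ∀ i, 0 ≤ p.1 i}

/-- An sc-smooth splicing `(π, E, V)`. Only the projections `π v` with `v ∈ V` matter. -/
structure Splicing : Type (u + 1) where
  W : ScBanach.{u}
  E : ScBanach.{u}
  C : Set W
  V : Set W
  π : W → E →L[ℝ] E
  quadrant : IsPartialQuadrant W C
  isOpen_V : ∃ G : Set W, IsOpen G ∧ V = C ∩ G
  idem : ∀ v ∈ V, ∀ e, π v (π v e) = π v e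
  smooth : IsScSmooth (W.scale.prod E.scale) E.scale (V ×ˢ univ) (fun p : W × E => π p.1 p.2)

namespace Splicing

/-- The scale of `W ⊕ E`. -/
def scale (S : Splicing.{u}) : Scale (S.W × S.E) := S.W.scale.prod S.E.scale

/-- The map `(v, e) ↦ (v, π_v e)` of `V ⊕ E` onto the splicing core. -/
def retr (S : Splicing.{u}) (p : S.W × S.E) : S.W × S.E := (p.1, S.π p.1 p.2)

/-- The splicing core. -/
def core (S : Splicing.{u}) : Set (S.W × S.E) := {p | p.1 ∈ S.V ∧ S.π p.1 p.2 = p.2}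

/-- `O` is an open subset of the splicing core. -/
def IsOpenInCore (S : Splicing.{u}) (O : Set (S.W × S.E)) : Prop :=
  ∃ G, IsOpen G ∧ O = S.core ∩ G

/-- The set `Ô` of all `(v, e) ∈ V ⊕ E` with `(v, π_v e) ∈ O`. -/
def hat (S : Splicing.{u}) (O : Set (S.W × S.E)) : Set (S.W × S.E) :=
  {p | p.1 ∈ S.V ∧ S.retr p ∈ O}

/-- A map on the subset `O` of the splicing core is sc-smooth if `(v, e) ↦ f (v, π_v e)` is
sc-smooth on `Ô`. -/
def SmoothOn (S : Splicing.{u}) {V₂ : Type w} [AddCommGroup V₂] [Module ℝ V₂] (S₂ : Scale V₂)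
    (O : Set (S.W × S.E)) (f : S.W × S.E → V₂) : Prop :=
  IsScSmooth S.scale S₂ (S.hat O) (f ∘ S.retr)

/-- The derivative at `x` of a map on the open subset `O` of the splicing core, as a linear map on
`W ⊕ E`; on the tangent space of `O` at `x` it is the tangent map. -/
noncomputable def deriv (S : Splicing.{u}) {V₂ : Type w} [AddCommGroup V₂] [Module ℝ V₂]
    (S₂ : Scale V₂) (O : Set (S.W × S.E)) (f : S.W × S.E → V₂) (x : S.W × S.E) :
    S.W × S.E →ₗ[ℝ] V₂ :=
  scDeriv S.scale S₂ (S.hat O) (f ∘ S.retr) x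

/-- The tangent space of the splicing core at `(v, e)`: all `(δv, δe)` with
`DΦ(v, e)(δv, δe) = δe`, where `Φ (v, e) = π_v e`. -/
noncomputable def tangentSpace (S : Splicing.{u}) (x : S.W × S.E) : Submodule ℝ (S.W × S.E) :=
  LinearMap.eqLocus
    (scDeriv S.scale S.E.scale (S.V ×ˢ univ) (fun p : S.W × S.E => S.π p.1 p.2) x)
    (LinearMap.snd ℝ S.W S.E)

end Splicing

/-! ## M-polyfolds -/

/-- An M-polyfold chart: a homeomorphism of an open subset of `X` onto an open subset of a
splicing core. -/
structure MChart (X : Type v) [TopologicalSpace X] : Type (max v (u + 1)) where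
  S : Splicing.{u}
  φ : PartialEquiv X (S.W × S.E)
  isOpen_source : IsOpen φ.source
  isOpen_target : S.IsOpenInCore φ.target
  continuousOn : ContinuousOn φ φ.source
  continuousOn_symm : ContinuousOn φ.symm φ.target

namespace MChart

variable {X : Type v} [TopologicalSpace X]

/-- The image in the chart `c` of the overlap of `c` and `d`. -/
def overlap (c d : MChart.{u} X) : Set (c.S.W × c.S.E) := c.φ '' (c.φ.source ∩ d.φ.source)

/-- The transition map from the chart `c` to the chart `d`. -/
def transition (c d : MChart.{u} X) : c.S.W × c.S.E → d.S.W × d.S.E := d.φ ∘ c.φ.symm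

/-- The charts are sc-smoothly compatible. -/
def Compatible (c d : MChart.{u} X) : Prop :=
  c.S.SmoothOn d.S.scale (c.overlap d) (c.transition d) ∧
  d.S.SmoothOn c.S.scale (d.overlap c) (d.transition c)

end MChart

/-- An M-polyfold structure: a maximal atlas of sc-smoothly compatible M-polyfold charts. -/
structure MPolyfold (X : Type v) [TopologicalSpace X] : Type (max v (u + 1)) where
  atlas : Set (MChart.{u} X)
  cover : ∀ x, ∃ c ∈ atlas, x ∈ c.φ.source
  compatible : ∀ c ∈ atlas, ∀ d ∈ atlas, c.Compatible d
  maximal : ∀ c : MChart.{u} X, (∀ d ∈ atlas, c.Compatible d) → c ∈ atlas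

namespace MPolyfold

variable {X : Type v} [TopologicalSpace X]

/-- The charts around `q`. -/
def ChartAt (M : MPolyfold.{u} X) (q : X) : Type (max v (u + 1)) :=
  {c : MChart.{u} X // c ∈ M.atlas ∧ q ∈ c.φ.source}

/-- `q` is a smooth point: it lies on all levels. -/
def IsSmoothPoint (M : MPolyfold.{u} X) (q : X) : Prop :=
  ∀ c : M.ChartAt q, c.1.φ q ∈ c.1.S.scale.inf

/-- The tangent space `T_qX`. A tangent vector is a class of pairs `(c, h)`, where `c` is a chart
around `q` and `h` is a tangent vector at `φ q` of the local model; the pairs `(c, h)` and `(d, k)`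
are equivalent if the tangent map of the transition map takes `h` to `k`. A class contains exactly
one pair for every chart around `q`, and it is given here as the family of these vectors. -/
noncomputable def tangentSpace (M : MPolyfold.{u} X) (q : X) :
    Submodule ℝ (∀ c : M.ChartAt q, c.1.S.W × c.1.S.E) where
  carrier := {h | (∀ c, h c ∈ c.1.S.tangentSpace (c.1.φ q)) ∧
    ∀ c d : M.ChartAt q,
      c.1.S.deriv d.1.S.scale (c.1.overlap d.1) (c.1.transition d.1) (c.1.φ q) (h c) = h d}
  zero_mem' := ⟨fun c => Submodule.zero_mem _, fun c d => by simp⟩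
  add_mem' := fun {a b} ha hb => ⟨fun c => Submodule.add_mem _ (ha.1 c) (hb.1 c), fun c d => by
    rw [Pi.add_apply, Pi.add_apply, map_add, ha.2 c d, hb.2 c d]⟩
  smul_mem' := fun r a ha => ⟨fun c => Submodule.smul_mem _ r (ha.1 c), fun c d => by
    rw [Pi.smul_apply, Pi.smul_apply, map_smul, ha.2 c d]⟩

/-- The representative of a tangent vector in a chart. -/
noncomputable def rep (M : MPolyfold.{u} X) {q : X} (c : M.ChartAt q) :
    M.tangentSpace q →ₗ[ℝ] c.1.S.W × c.1.S.E :=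
  (LinearMap.proj c).comp (M.tangentSpace q).subtype

end MPolyfold

/-! ## Strong M-polyfold bundles -/

/-- A strong bundle splicing `(ρ, F, (O, S))`: both `(ρ, F, (O, S))` and `(ρ, F^1, (O, S))` are
general sc-smooth splicings. Only the projections `ρ x` with `x ∈ O` matter. -/
structure StrongBundleSplicing (S : Splicing.{u}) (O : Set (S.W × S.E)) : Type (u + 1) where
  F : ScBanach.{u}
  ρ : S.W × S.E → F →L[ℝ] F
  idem : ∀ x ∈ O, ∀ y, ρ x (ρ x y) = ρ x y
  smooth : IsScSmooth (S.scale.prod F.scale) F.scale (S.hat O ×ˢ univ)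
    (fun p : (S.W × S.E) × F => ρ (S.retr p.1) p.2)
  level_succ : ∀ m, ∀ x ∈ O, x ∈ S.scale.level m → ∀ y ∈ F.scale.level (m + 1),
    ρ x y ∈ F.scale.level (m + 1)
  smooth_one : IsScSmooth (S.scale.prod (F.scale.shift 1)) (F.scale.shift 1)
    (S.hat O ×ˢ (F.scale.level 1 : Set F)) (fun p : (S.W × S.E) × F => ρ (S.retr p.1) p.2)

namespace StrongBundleSplicing

variable {S : Splicing.{u}} {O : Set (S.W × S.E)}

/-- The splicing core `K^R`. -/
def core (R : StrongBundleSplicing S O) : Set ((S.W × S.E) × R.F) :=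
  {p | p.1 ∈ O ∧ R.ρ p.1 p.2 = p.2}

/-- The map `(v, e, y) ↦ (v, π_v e, ρ_{(v, π_v e)} y)`. -/
def retr (R : StrongBundleSplicing S O) (p : (S.W × S.E) × R.F) : (S.W × S.E) × R.F :=
  (S.retr p.1, R.ρ (S.retr p.1) p.2)

end StrongBundleSplicing

/-- The total space of a family of fibers. -/
abbrev BundleTotal {X : Type v} (Y : X → Type w) : Type (max v w) := Bundle.TotalSpace PUnit.{1} Y

section Bundle

variable {X : Type v} [TopologicalSpace X] (Y : X → Type w) [∀ x, NormedAddCommGroup (Y x)]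
  [∀ x, NormedSpace ℝ (Y x)] [TopologicalSpace (BundleTotal Y)]

/-- A strong M-polyfold bundle chart: a homeomorphism `Φ` of `p⁻¹(U)` onto the splicing core of a
strong bundle splicing, which covers the chart `base : U → O` and is linear on the fibers. The
linear isomorphism which `Φ` induces from the fiber over `x ∈ U` onto the image of `ρ_{φ(x)}` is
`fib x`, and it is a homeomorphism for the norm of the fiber. -/
structure BundleChart : Type (max v w (u + 1)) where
  base : MChart.{u} X
  R : StrongBundleSplicing base.S base.φ.target
  Φ : PartialEquiv (BundleTotal Y) ((base.S.W × base.S.E) × R.F)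
  fib : ∀ x, Y x →L[ℝ] R.F
  source_eq : Φ.source = {y | y.proj ∈ base.φ.source}
  target_eq : Φ.target = R.core
  apply_eq : ∀ y ∈ Φ.source, Φ y = (base.φ y.proj, fib y.proj y.snd)
  bounded_below : ∀ x ∈ base.φ.source, ∃ K : ℝ, ∀ y, ‖y‖ ≤ K * ‖fib x y‖
  continuousOn : ContinuousOn Φ Φ.source
  continuousOn_symm : ContinuousOn Φ.symm Φ.target

namespace BundleChart

variable {Y}

/-- The transition map from `c` to `d` is sc-smooth as a map `K^R(i) → K^{R'}(i)`, where the level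
`m` of `K^R(i)` consists of the points of `K^R` in `O_m ⊕ F_{m+i}`. As for splicing cores,
sc-smoothness is that of the composition with the projection `(v, e, y) ↦ (v, π_v e, ρ y)`. -/
def TransitionSmooth (i : ℕ) (c d : BundleChart.{u} Y) : Prop :=
  IsScSmooth (c.base.S.scale.prod (c.R.F.scale.shift i)) (d.base.S.scale.prod (d.R.F.scale.shift i))
    (c.base.S.hat (c.base.overlap d.base) ×ˢ (c.R.F.scale.level i : Set c.R.F))
    (d.Φ ∘ c.Φ.symm ∘ c.R.retr)

/-- The transition maps between the charts, in both directions, are sc_◁-smooth strong bundle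
maps. -/
def Compatible (c d : BundleChart.{u} Y) : Prop :=
  TransitionSmooth 0 c d ∧ TransitionSmooth 1 c d ∧
  TransitionSmooth 0 d c ∧ TransitionSmooth 1 d c

/-- The principal part in the chart `c` of a section of the bundle. -/
def principal (c : BundleChart.{u} Y) (f : ∀ x, Y x) (p : c.base.S.W × c.base.S.E) : c.R.F :=
  c.fib (c.base.φ.symm p) (f (c.base.φ.symm p))

end BundleChart

/-- A strong M-polyfold bundle over the M-polyfold `X`: a maximal atlas of strong bundle charts,
which cover charts of `X` and have sc_◁-smooth transition maps. The total space carries the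
M-polyfold structure (of type 1) for which these charts are sc-diffeomorphisms. -/
structure StrongBundle (M : MPolyfold.{u} X) : Type (max v w (u + 1)) where
  atlas : Set (BundleChart.{u} Y)
  continuous_proj : Continuous (fun y : BundleTotal Y => y.proj)
  base_mem : ∀ c ∈ atlas, c.base ∈ M.atlas
  cover : ∀ x, ∃ c ∈ atlas, x ∈ c.base.φ.source
  compatible : ∀ c ∈ atlas, ∀ d ∈ atlas, c.Compatible d
  maximal : ∀ c : BundleChart.{u} Y, c.base ∈ M.atlas → (∀ d ∈ atlas, c.Compatible d) → c ∈ atlas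

namespace StrongBundle

variable {Y} {M : MPolyfold.{u} X}

/-- The bundle charts around `q`. -/
def ChartAt (B : StrongBundle Y M) (q : X) : Type (max v w (u + 1)) :=
  {c : BundleChart.{u} Y // c ∈ B.atlas ∧ q ∈ c.base.φ.source}

/-- The chart of the base which is covered by a bundle chart. -/
def ChartAt.toBase {B : StrongBundle Y M} {q : X} (c : B.ChartAt q) : M.ChartAt q :=
  ⟨c.1.base, B.base_mem c.1 c.2.1, c.2.2⟩

/-- On a neighborhood of `q`, the section is sc-smooth as a section of the bundles with local
models `K^R(i) → O`: its principal parts are sc-smooth maps `O → F^i`. -/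
def SmoothSectionNear (B : StrongBundle Y M) (i : ℕ) (f : ∀ x, Y x) (q : X) : Prop :=
  ∃ N : Set X, IsOpen N ∧ q ∈ N ∧ ∀ c ∈ B.atlas,
    c.base.S.SmoothOn (c.R.F.scale.shift i) (c.base.φ '' (c.base.φ.source ∩ N)) (c.principal f)

/-- `f` represents the germ at `q` of an sc-smooth section. -/
def IsScSection (B : StrongBundle Y M) (f : ∀ x, Y x) (q : X) : Prop :=
  B.SmoothSectionNear 0 f q

/-- `s` represents the germ at `q` of an sc⁺-section. -/
def IsScPlusSection (B : StrongBundle Y M) (s : ∀ x, Y x) (q : X) : Prop :=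
  B.SmoothSectionNear 0 s q ∧ B.SmoothSectionNear 1 s q

/-- `L = P_q ∘ T(f - s)(q)` in every bundle chart around `q`: the derivative at `φ q` of the
principal part of `f - s`, applied to the representative of a tangent vector. -/
def IsLinearization (B : StrongBundle Y M) (f s : ∀ x, Y x) (q : X)
    (L : M.tangentSpace q →ₗ[ℝ] Y q) : Prop :=
  ∀ (c : B.ChartAt q) (h : M.tangentSpace q),
    c.1.fib q (L h) =
      c.1.base.S.deriv c.1.R.F.scale c.1.base.φ.target (c.1.principal (f - s)) (c.1.base.φ q)
        (M.rep c.toBase h)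

open Classical in
/-- The linearization `f'_{[s]}(q)`, for `f q = s q`. -/
noncomputable def linearization (B : StrongBundle Y M) (f s : ∀ x, Y x) (q : X) :
    M.tangentSpace q →ₗ[ℝ] Y q :=
  if h : ∃ L, B.IsLinearization f s q L then h.choose else 0

/-- The sc-structure which a bundle chart around the smooth point `q` induces on `T_qX`. Other
charts induce the same levels with equivalent norms. -/
noncomputable def tangentScale (B : StrongBundle Y M) {q : X} (c : B.ChartAt q) :
    Scale (M.tangentSpace q) :=
  c.1.base.S.scale.comap (M.rep c.toBase)

/-- The sc-structure which a bundle chart around the smooth point `q` induces on the fiber over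
`q`. Other charts induce the same levels with equivalent norms. -/
def fiberScale (B : StrongBundle Y M) {q : X} (c : B.ChartAt q) : Scale (Y q) :=
  c.1.R.F.scale.comap (c.1.fib q : Y q →ₗ[ℝ] c.1.R.F)

end StrongBundle

end Bundle

/-! ## Compact perturbations of the identity -/

namespace IsCompactOperator

variable {E : Type*} [NormedAddCommGroup E] [NormedSpace ℝ E]

/-! In a bundle chart `c` let g_c be the principal part of f - s; it vanishes at φ(q). If τ is the
base transition to a second chart `d`, then g_d(τ z) = Γ(z) g_c(z) with Γ(z) linear, the fiber part
of the bundle transition. Because g_c(φ(q)) = 0, no derivative of Γ enters: the right side has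
linearization Γ(φ(q)) ∘ Dg_c, and the left side has Dg_d ∘ Dτ by the chain rule. Linearizations are
unique on relatively open subsets of a spanning cone, so Dg_c and Dg_d describe the same vectors of
Y_q. For d = c the map Γ(z) is the projection ρ, so Dg_c has values in the fiber
(`exists_fib_eq_of_hasScDerivAt`, `exists_isLinearization`).

The analytic difficulty is that sc-smoothness makes (y, k) ↦ L_y k jointly continuous, but does not
make y ↦ L_y continuous in operator norm. Compactness of E_1 → E_0 makes the convergence uniform on
bounded sets of E_1 (`IsScFamily.uniform`), which is what the rule for Γ g and the chain rule
`HasScDerivAt.comp` need.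

In the difference of two linearizations the derivative of f cancels, leaving Dt - Ds. The tangent
map of the principal part of an sc⁺-section is sc⁰ into the tangent of F^1. At a smooth point it can
be evaluated on every level, so by linearity its derivative is bounded E_m → F_{m+1}
(`IsScZero.exists_bound_of_tangent`).

Fredholm stability goes through parametrices. An sc-Fredholm T has an sc-operator R inverting it
modulo sc⁺-operators, and the same R serves T + P for every sc⁺-operator P. Conversely a parametrix
makes an operator sc-Fredholm by a regularity bootstrap (`isScFredholm_of_parametrix`).
Sc⁺-operators are compact on level 0, so R T and R (T + P) are compact perturbations of the identity
and have index 0; additivity of the index gives ind T = -ind R = ind (T + P). -/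

theorem finiteDimensional_ker_one_add {K : E →L[ℝ] E} (hK : IsCompactOperator K) :
    FiniteDimensional ℝ (1 + K : E →L[ℝ] E).ker := by
  set N := (1 + K : E →L[ℝ] E).ker with hN
  have hNc : IsClosed (N : Set E) := (1 + K : E →L[ℝ] E).isClosed_ker
  have hKN : ∀ x ∈ N, K x = -x := fun x hx => by
    have : x + K x = 0 := hx
    exact eq_neg_of_add_eq_zero_right this
  have hc : IsCompactOperator (fun x : N => (K x : E)) := hK.comp_clm N.subtypeL
  -- On the kernel K is -id, so the identity of the kernel is compact and Riesz's theorem applies.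
  have h2 : IsCompactOperator (id : N → N) := by
    have h3 := (hc.codRestrict (V := N) (fun x => by rw [hKN x x.2]; exact N.neg_mem x.2) hNc).neg
    have h4 : (id : N → N) = -Set.codRestrict (fun x : N => (K x : E)) N
        (fun x => by rw [hKN x x.2]; exact N.neg_mem x.2) := by
      funext x
      exact Subtype.ext (by simp [hKN x x.2])
    rw [h4]
    exact h3
  exact FiniteDimensional.of_isCompactOperator_id h2

variable [CompleteSpace E]

/-- Fredholm alternative at -1: an eigenvector of K for -1 would lie in the kernel of 1 + K, so -1
is in the resolvent set. -/
theorem bijective_of_injective_one_add {K : E →L[ℝ] E} (hK : IsCompactOperator K)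
    (hinj : Function.Injective (1 + K : E →L[ℝ] E)) :
    Function.Bijective (1 + K : E →L[ℝ] E) := by
  rcases hK.hasEigenvalue_or_mem_resolventSet (μ := (-1 : ℝ)) (by norm_num) with h | h
  · obtain ⟨v, hv⟩ := h.exists_hasEigenvector
    have h1 : K v = (-1 : ℝ) • v := hv.apply_eq_smul
    refine absurd (hinj ?_) hv.2
    simp [h1]
  · rw [spectrum.mem_resolventSet_iff, ← IsUnit.neg_iff,
      ContinuousLinearMap.isUnit_iff_bijective] at h
    convert h using 2
    ext x
    simp [add_comm]

/-- No duality is needed: invert 1 + K on a closed complement of its kernel. The resulting right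
inverse R equals 1 - K R, again a compact perturbation of the identity, and is injective; hence it
is bijective, and 1 + K, a left inverse of a bijection, is injective. -/
theorem injective_of_surjective_one_add {K : E →L[ℝ] E} (hK : IsCompactOperator K)
    (hsurj : Function.Surjective (1 + K : E →L[ℝ] E)) :
    Function.Injective (1 + K : E →L[ℝ] E) := by
  set B : E →L[ℝ] E := 1 + K with hB
  have := hK.finiteDimensional_ker_one_add
  obtain ⟨M, hM⟩ := (Submodule.ClosedComplemented.of_finiteDimensional B.ker).exists_isTopCompl
  have hMc : IsClosed (M : Set E) := hM.symm.isClosed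
  have : CompleteSpace M := hMc.completeSpace_coe
  let f : M →L[ℝ] E := B.comp M.subtypeL
  have hf0 : f.ker = ⊥ := by
    refine LinearMap.ker_eq_bot'.2 fun x hx => ?_
    have : (x : E) ∈ B.ker ⊓ M := ⟨hx, x.2⟩
    rw [hM.isCompl.inf_eq_bot] at this
    exact Subtype.ext this
  have hf1 : f.range = ⊤ := by
    refine LinearMap.range_eq_top.2 fun y => ?_
    obtain ⟨x, rfl⟩ := hsurj y
    have hx : x ∈ B.ker ⊔ M := by rw [hM.isCompl.sup_eq_top]; trivial
    obtain ⟨a, ha, b, hb, rfl⟩ := Submodule.mem_sup.1 hx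
    have ha : B a = 0 := ha
    exact ⟨⟨b, hb⟩, by simp [f, ha]⟩
  let e := ContinuousLinearEquiv.ofBijective f hf0 hf1
  let R : E →L[ℝ] E := M.subtypeL.comp (e.symm : E →L[ℝ] M)
  have hBR : ∀ x, B (R x) = x := fun x =>
    ContinuousLinearEquiv.ofBijective_apply_symm_apply f hf0 hf1 x
  have hR : R = 1 + -(K.comp R) := by
    ext x
    have h1 := hBR x
    have h2 : R x + K (R x) = x := h1
    have h3 : R x = x - K (R x) := eq_sub_of_add_eq h2
    simpa [sub_eq_add_neg] using h3
  have hRc : IsCompactOperator (-(K.comp R)) := (hK.comp_clm R).neg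
  have hRb := hRc.bijective_of_injective_one_add (by
    rw [← hR]
    exact Function.LeftInverse.injective hBR)
  rw [← hR] at hRb
  intro x y hxy
  obtain ⟨a, rfl⟩ := hRb.2 x
  obtain ⟨b, rfl⟩ := hRb.2 y
  rw [hBR, hBR] at hxy
  rw [hxy]

/-- A compact perturbation of the identity has finite dimensional kernel and cokernel, and index
zero. -/
theorem fredholm_one_add {K : E →L[ℝ] E} (hK : IsCompactOperator K) :
    FiniteDimensional ℝ (1 + K : E →L[ℝ] E).ker ∧
    FiniteDimensional ℝ (E ⧸ (1 + K : E →L[ℝ] E).range) ∧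
    (1 + K : E →L[ℝ] E).toLinearMap.index = 0 := by
  set A : E →L[ℝ] E := 1 + K with hA
  have hfin : FiniteDimensional ℝ A.ker := hK.finiteDimensional_ker_one_add
  obtain ⟨p, hp⟩ := Submodule.ClosedComplemented.of_finiteDimensional A.ker
  obtain ⟨Z, hZ⟩ := A.range.exists_isCompl
  -- `A` plus a map from its kernel to the complement of its range
  have key : ∀ J : A.ker →ₗ[ℝ] Z, ∃ K' : E →L[ℝ] E, IsCompactOperator K' ∧
      ∀ x, (1 + K') x = A x + J (p x) := fun J => by
    let J' : A.ker →L[ℝ] E := LinearMap.toContinuousLinearMap (Z.subtype ∘ₗ J)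
    have hJ : IsCompactOperator (J'.comp p) :=
      (isCompactOperator_id (E := A.ker)).comp_clm p |>.continuous_comp J'.continuous
    refine ⟨K + J'.comp p, hK.add hJ, fun x => ?_⟩
    simp [hA, J', add_assoc]
  have split : ∀ (J : A.ker →ₗ[ℝ] Z) x, A x + J (p x) = 0 → A x = 0 ∧ J (p x) = 0 := by
    intro J x hx
    have h1 : A x ∈ A.range ⊓ Z := ⟨⟨x, rfl⟩, by
      rw [eq_neg_of_add_eq_zero_left hx]; exact Z.neg_mem (J (p x)).2⟩
    rw [hZ.inf_eq_bot] at h1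
    have h1 : A x = 0 := h1
    refine ⟨h1, Subtype.ext ?_⟩
    simpa [h1] using hx
  -- Adding J on the kernel makes `A` injective exactly when J is injective, and surjective exactly
  -- when J is surjective, so the two previous lemmas transfer to J.
  have surj_of_inj : ∀ J : A.ker →ₗ[ℝ] Z, Function.Injective J → Function.Surjective J := by
    intro J hJ z
    obtain ⟨K', hK', h⟩ := key J
    have hinj : Function.Injective (1 + K' : E →L[ℝ] E) := by
      refine (injective_iff_map_eq_zero _).2 fun x hx => ?_
      rw [h] at hx
      obtain ⟨h1, h2⟩ := split J x hx
      have h3 : p x = 0 := hJ (h2.trans (map_zero J).symm)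
      have h4 := hp ⟨x, h1⟩
      have h5 := congrArg Subtype.val (h4.symm.trans h3)
      simpa using h5
    obtain ⟨x, hx⟩ := (hK'.bijective_of_injective_one_add hinj).2 z
    rw [h] at hx
    refine ⟨p x, Subtype.ext ?_⟩
    have h1 : A x ∈ A.range ⊓ Z := ⟨⟨x, rfl⟩, by
      rw [eq_sub_of_add_eq hx]; exact Z.sub_mem z.2 (J (p x)).2⟩
    rw [hZ.inf_eq_bot] at h1
    have h1 : A x = 0 := h1
    simpa [h1] using hx
  have inj_of_surj : ∀ J : A.ker →ₗ[ℝ] Z, Function.Surjective J → Function.Injective J := by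
    intro J hJ
    obtain ⟨K', hK', h⟩ := key J
    have hsurj : Function.Surjective (1 + K' : E →L[ℝ] E) := by
      intro y
      have hy : y ∈ A.range ⊔ Z := by rw [hZ.sup_eq_top]; trivial
      obtain ⟨_, ⟨a, rfl⟩, z, hz, rfl⟩ := Submodule.mem_sup.1 hy
      obtain ⟨n, hn⟩ := hJ ⟨z, hz⟩
      have hn0 : ∀ m : A.ker, A m = 0 := fun m => m.2
      refine ⟨a - p a + n, ?_⟩
      rw [h]
      simp [hn0, hp, hn]
    have hinj := hK'.injective_of_surjective_one_add hsurj
    refine (injective_iff_map_eq_zero _).2 fun n hn => ?_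
    have hn0 : A n = 0 := n.2
    have : (1 + K') (n : E) = (1 + K') 0 := by
      rw [h, h, hn0, hp, hn]
      simp
    exact Subtype.ext (hinj this)
  -- The cokernel is not yet known to be finite dimensional, so cardinal ranks are compared. Either
  -- order yields a linear map which is injective or surjective, hence bijective.
  obtain ⟨J, hJ⟩ : ∃ J : A.ker →ₗ[ℝ] Z, Function.Bijective J := by
    rcases le_total (Module.rank ℝ A.ker) (Module.rank ℝ Z) with hle | hle
    · obtain ⟨J, hJ⟩ := rank_le_iff_exists_linearMap.1 hle
      exact ⟨J, hJ, surj_of_inj J hJ⟩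
    · obtain ⟨J', hJ'⟩ := rank_le_iff_exists_linearMap.1 hle
      obtain ⟨J, hJ⟩ := J'.exists_leftInverse_of_injective (LinearMap.ker_eq_bot.2 hJ')
      have hs : Function.Surjective J := fun z => ⟨J' z, LinearMap.congr_fun hJ z⟩
      exact ⟨J, inj_of_surj J hs, hs⟩
  let e := (LinearEquiv.ofBijective J hJ).trans (A.range.quotientEquivOfIsCompl Z hZ).symm
  have hcok : FiniteDimensional ℝ (E ⧸ A.range) := e.finiteDimensional
  refine ⟨hfin, hcok, ?_⟩
  rw [LinearMap.index_eq_finrank_sub, sub_eq_zero, Nat.cast_inj]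
  exact e.finrank_eq

end IsCompactOperator

/-! ## Elementary properties of sc-structures -/

namespace Scale

variable {V : Type*} [AddCommGroup V] [Module ℝ V] {V₂ : Type*} [AddCommGroup V₂] [Module ℝ V₂]
  {V₃ : Type*} [AddCommGroup V₃] [Module ℝ V₃]

theorem inf_le_level (S : Scale V) (m : ℕ) : S.inf ≤ S.level m := iInf_le _ _

namespace IsSc

variable {S : Scale V} {m n : ℕ} {x y : V}

theorem mem_zero (hS : S.IsSc) (x : V) : x ∈ S.level 0 := by
  rw [hS.level_zero]
  trivial

theorem level_anti (hS : S.IsSc) : Antitone S.level := antitone_nat_of_succ_le hS.nested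

theorem nrm_map_zero (hS : S.IsSc) (m : ℕ) : S.nrm m 0 = 0 := by
  simpa using hS.nrm_smul m 0 0 (zero_mem _)

theorem nrm_neg (hS : S.IsSc) (hx : x ∈ S.level m) : S.nrm m (-x) = S.nrm m x := by
  simpa using hS.nrm_smul m (-1) x hx

/-- Not an axiom of `IsSc`; it comes from the triangle inequality for x and -x. -/
theorem nrm_nonneg (hS : S.IsSc) (hx : x ∈ S.level m) : 0 ≤ S.nrm m x := by
  have h := hS.nrm_add m x hx (-x) (neg_mem hx)
  rw [add_neg_cancel, hS.nrm_map_zero, hS.nrm_neg hx] at h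
  linarith

theorem nrm_sub_le (hS : S.IsSc) (hx : x ∈ S.level m) (hy : y ∈ S.level m) :
    S.nrm m (x - y) ≤ S.nrm m x + S.nrm m y := by
  have h := hS.nrm_add m x hx (-y) (neg_mem hy)
  rwa [← sub_eq_add_neg, hS.nrm_neg hy] at h

theorem nrm_sub_comm (hS : S.IsSc) (hx : x ∈ S.level m) (hy : y ∈ S.level m) :
    S.nrm m (x - y) = S.nrm m (y - x) := by
  rw [← neg_sub, hS.nrm_neg (sub_mem hy hx)]

theorem nrm_le_add_sub (hS : S.IsSc) (hx : x ∈ S.level m) (hy : y ∈ S.level m) :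
    S.nrm m x ≤ S.nrm m y + S.nrm m (x - y) := by
  simpa using hS.nrm_add m y hy (x - y) (sub_mem hx hy)

theorem nrm_pos (hS : S.IsSc) (hx : x ∈ S.level m) (h : x ≠ 0) : 0 < S.nrm m x :=
  (hS.nrm_nonneg hx).lt_of_ne fun h0 => h (hS.eq_zero_of_nrm m x hx h0.symm)

/-- Bounded sequences in a level have subsequences which converge in lower levels. -/
theorem exists_subseq (hS : S.IsSc) (h : m < n) {a : ℕ → V} {K : ℝ} (ha : ∀ i, a i ∈ S.level n)
    (haK : ∀ i, S.nrm n (a i) ≤ K) :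
    ∃ x ∈ S.level m, ∃ σ : ℕ → ℕ, StrictMono σ ∧
      Tendsto (fun i => S.nrm m (a (σ i) - x)) atTop (𝓝 0) := by
  have hK : 0 < max K 1 := lt_max_of_lt_right one_pos
  obtain ⟨x, hx, σ, hσ, hlim⟩ := hS.compact m n h (fun i => (max K 1)⁻¹ • a i) fun i => by
    refine ⟨Submodule.smul_mem _ _ (ha i), ?_⟩
    rw [hS.nrm_smul n _ _ (ha i), abs_of_pos (inv_pos.2 hK), inv_mul_le_iff₀ hK, mul_one]
    exact (haK i).trans (le_max_left _ _)
  refine ⟨max K 1 • x, Submodule.smul_mem _ _ hx, σ, hσ, ?_⟩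
  have h1 : ∀ i, S.nrm m (a (σ i) - max K 1 • x) =
      max K 1 * S.nrm m ((max K 1)⁻¹ • a (σ i) - x) := fun i => by
    have h2 : (max K 1)⁻¹ • a (σ i) - x ∈ S.level m :=
      sub_mem (Submodule.smul_mem _ _ (hS.level_anti h.le (ha _))) hx
    have h3 := hS.nrm_smul m (max K 1) _ h2
    rwa [abs_of_pos hK, smul_sub, smul_inv_smul₀ hK.ne'] at h3
  simpa [h1] using hlim.const_mul (max K 1)

/-- The inclusions of the levels are bounded. -/
theorem exists_nrm_le (hS : S.IsSc) (h : m ≤ n) :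
    ∃ K, 0 ≤ K ∧ ∀ x ∈ S.level n, S.nrm m x ≤ K * S.nrm n x := by
  rcases h.eq_or_lt with rfl | h
  · exact ⟨1, zero_le_one, fun x _ => by rw [one_mul]⟩
  -- Boundedness is extracted from compactness: normalized counterexamples lie in the unit ball of
  -- level n while their norms in level m are unbounded, which contradicts a subsequence convergent
  -- in level m.
  by_contra! hcon
  choose x hx hlt using fun i : ℕ => hcon i i.cast_nonneg
  have hpos : ∀ i, 0 < S.nrm n (x i) := fun i => hS.nrm_pos (hx i) fun h0 => by
    have := hlt i
    rw [h0, hS.nrm_map_zero, hS.nrm_map_zero, mul_zero] at this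
    exact lt_irrefl _ this
  obtain ⟨y, hy, σ, hσ, hlim⟩ := hS.compact m n h (fun i => (S.nrm n (x i))⁻¹ • x i) fun i =>
    ⟨Submodule.smul_mem _ _ (hx i), by
      rw [hS.nrm_smul n _ _ (hx i), abs_of_pos (inv_pos.2 (hpos i)), inv_mul_cancel₀ (hpos i).ne']⟩
  obtain ⟨N, hN⟩ := exists_nat_gt (S.nrm m y + 1)
  obtain ⟨i, hi, hiN⟩ :=
    ((hlim.eventually (gt_mem_nhds one_pos)).and (eventually_ge_atTop N)).exists
  have hxm := hS.level_anti h.le (hx (σ i))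
  have h1 := hS.nrm_le_add_sub (Submodule.smul_mem _ (S.nrm n (x (σ i)))⁻¹ hxm) hy
  rw [hS.nrm_smul m _ _ hxm, abs_of_pos (inv_pos.2 (hpos _))] at h1
  have h2 : (σ i : ℝ) < (S.nrm n (x (σ i)))⁻¹ * S.nrm m (x (σ i)) := by
    rw [inv_mul_eq_div, lt_div_iff₀ (hpos _)]
    exact hlt _
  have h3 : (N : ℝ) ≤ σ i := by exact_mod_cast hiN.trans (hσ.id_le i)
  linarith

/-- A linear map which is bounded on a small ball is bounded. -/
theorem exists_bound_of_ball (hS : S.IsSc) {S₂ : Scale V₂} (hS₂ : S₂.IsSc) {T : V → V₂}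
    (hT : IsLinearMap ℝ T) {δ : ℝ} (hδ : 0 < δ)
    (h : ∀ x ∈ S.level m, S.nrm m x < δ → T x ∈ S₂.level n ∧ S₂.nrm n (T x) ≤ 1) :
    ∀ x ∈ S.level m, T x ∈ S₂.level n ∧ S₂.nrm n (T x) ≤ 2 / δ * S.nrm m x := by
  intro x hx
  rcases eq_or_ne x 0 with rfl | h0
  · rw [hT.map_zero, hS.nrm_map_zero, hS₂.nrm_map_zero, mul_zero]
    exact ⟨zero_mem _, le_rfl⟩
  have hp := hS.nrm_pos hx h0
  set c := δ / (2 * S.nrm m x) with hc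
  have hcp : 0 < c := by positivity
  obtain ⟨h1, h2⟩ := h (c • x) (Submodule.smul_mem _ _ hx) (by
    rw [hS.nrm_smul m _ _ hx, abs_of_pos hcp, hc]
    field_simp
    norm_num)
  rw [hT.map_smul] at h1 h2
  have h3 : T x ∈ S₂.level n := by simpa [hcp.ne'] using Submodule.smul_mem _ c⁻¹ h1
  refine ⟨h3, ?_⟩
  rw [hS₂.nrm_smul n _ _ h3, abs_of_pos hcp, hc] at h2
  field_simp at h2 ⊢
  linarith

theorem prod {S₂ : Scale V₂} (hS : S.IsSc) (hS₂ : S₂.IsSc) : (S.prod S₂).IsSc where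
  level_zero := by simp [Scale.prod, hS.level_zero, hS₂.level_zero]
  nested m := fun x hx => ⟨hS.nested m hx.1, hS₂.nested m hx.2⟩
  nrm_add m x hx y hy := max_le
    ((hS.nrm_add m _ hx.1 _ hy.1).trans (add_le_add (le_max_left _ _) (le_max_left _ _)))
    ((hS₂.nrm_add m _ hx.2 _ hy.2).trans (add_le_add (le_max_right _ _) (le_max_right _ _)))
  nrm_smul m a x hx := by
    simp only [Scale.prod, Prod.smul_fst, Prod.smul_snd, hS.nrm_smul m a _ hx.1,
      hS₂.nrm_smul m a _ hx.2]
    exact (mul_max_of_nonneg _ _ (abs_nonneg a)).symm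
  eq_zero_of_nrm m x hx h := by
    have h1 : S.nrm m x.1 ≤ 0 := h ▸ le_max_left _ _
    have h2 : S₂.nrm m x.2 ≤ 0 := h ▸ le_max_right _ _
    exact Prod.ext (hS.eq_zero_of_nrm m _ hx.1 (h1.antisymm (hS.nrm_nonneg hx.1)))
      (hS₂.eq_zero_of_nrm m _ hx.2 (h2.antisymm (hS₂.nrm_nonneg hx.2)))
  complete m a ha hc := by
    obtain ⟨x, hx, hxl⟩ := hS.complete m (fun i => (a i).1) (fun i => (ha i).1) fun ε hε =>
      (hc ε hε).imp fun N hN i hi j hj => (le_max_left _ _).trans_lt (hN i hi j hj)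
    obtain ⟨y, hy, hyl⟩ := hS₂.complete m (fun i => (a i).2) (fun i => (ha i).2) fun ε hε =>
      (hc ε hε).imp fun N hN i hi j hj => (le_max_right _ _).trans_lt (hN i hi j hj)
    exact ⟨(x, y), ⟨hx, hy⟩, by simpa [Scale.prod] using hxl.max hyl⟩
  compact m n h a ha := by
    obtain ⟨x, hx, σ, hσ, hxl⟩ := hS.compact m n h (fun i => (a i).1) fun i =>
      ⟨(ha i).1.1, (le_max_left _ _).trans (ha i).2⟩
    obtain ⟨y, hy, τ, hτ, hyl⟩ := hS₂.compact m n h (fun i => (a (σ i)).2) fun i =>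
      ⟨(ha _).1.2, (le_max_right _ _).trans (ha _).2⟩
    exact ⟨(x, y), ⟨hx, hy⟩, σ ∘ τ, hσ.comp hτ, by
      simpa [Scale.prod] using (hxl.comp hτ.tendsto_atTop).max hyl⟩
  dense m x hx ε hε := by
    obtain ⟨y, hy, hy'⟩ := hS.dense m x.1 hx.1 ε hε
    obtain ⟨z, hz, hz'⟩ := hS₂.dense m x.2 hx.2 ε hε
    simp only [inf, Submodule.mem_iInf] at hy hz ⊢
    exact ⟨(y, z), fun i => ⟨hy i, hz i⟩, max_lt hy' hz'⟩

/-- Being in a subspace which is closed at level `0` is a closed condition on all levels. -/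
theorem mem_of_tendsto (hS : S.IsSc) {F : Submodule ℝ V}
    (hF : ∀ x ∈ S.level 0, (∀ ε > 0, ∃ y ∈ F, S.nrm 0 (x - y) < ε) → x ∈ F) {a : ℕ → V}
    (ha : ∀ i, a i ∈ F) (ham : ∀ i, a i ∈ S.level m) (hx : x ∈ S.level m)
    (hlim : Tendsto (fun i => S.nrm m (a i - x)) atTop (𝓝 0)) : x ∈ F := by
  obtain ⟨K, hK, hle⟩ := hS.exists_nrm_le (Nat.zero_le m)
  have h0 : Tendsto (fun i => S.nrm 0 (a i - x)) atTop (𝓝 0) :=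
    squeeze_zero (fun i => hS.nrm_nonneg (hS.mem_zero _)) (fun i => hle _ (sub_mem (ham i) hx))
      (by simpa using hlim.const_mul K)
  refine hF x (hS.mem_zero x) fun ε hε => ?_
  obtain ⟨i, hi⟩ := (h0.eventually (gt_mem_nhds hε)).exists
  exact ⟨a i, ha i, by rwa [hS.nrm_sub_comm (hS.mem_zero _) (hS.mem_zero _)]⟩

/-- A closed subspace whose smooth points are dense on all levels is an sc-subspace. -/
theorem isScSubspace (hS : S.IsSc) {F : Submodule ℝ V}
    (hF : ∀ x ∈ S.level 0, (∀ ε > 0, ∃ y ∈ F, S.nrm 0 (x - y) < ε) → x ∈ F)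
    (hd : ∀ m, ∀ x ∈ F, x ∈ S.level m → ∀ ε > 0, ∃ y ∈ F, y ∈ S.inf ∧ S.nrm m (x - y) < ε) :
    S.IsScSubspace F := by
  refine ⟨hF, ⟨?_, fun m x hx => hS.nested m hx, fun m x hx y hy => hS.nrm_add m x hx y hy,
    fun m a x hx => hS.nrm_smul m a x hx, fun m x hx h => Subtype.ext (hS.eq_zero_of_nrm m x hx h),
    fun m a ha hc => ?_, fun m n h a ha => ?_, fun m x hx ε hε => ?_⟩⟩
  · refine eq_top_iff.2 fun x _ => hS.mem_zero (x : V)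
  · obtain ⟨x, hx, hlim⟩ := hS.complete m (fun i => (a i : V)) ha hc
    exact ⟨⟨x, hS.mem_of_tendsto hF (fun i => (a i).2) ha hx hlim⟩, hx, hlim⟩
  · obtain ⟨x, hx, σ, hσ, hlim⟩ := hS.compact m n h (fun i => (a i : V)) ha
    exact ⟨⟨x, hS.mem_of_tendsto hF (fun i => (a (σ i)).2)
      (fun i => hS.level_anti h.le (ha _).1) hx hlim⟩, hx, σ, hσ, hlim⟩
  · obtain ⟨y, hyF, hy, hlt⟩ := hd m x x.2 hx ε hε
    refine ⟨⟨y, hyF⟩, ?_, hlt⟩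
    simp only [inf, Submodule.mem_iInf] at hy ⊢
    exact hy

end IsSc

/-! ### Sc-operators and sc⁺-operators -/

section Operators

variable {S : Scale V} {S₂ : Scale V₂} {S₃ : Scale V₃} {T T' : V →ₗ[ℝ] V₂}

theorem IsScOperator.bound (hS : S.IsSc) (hT : S.IsScOperator S₂ T) (m : ℕ) :
    ∃ K, 0 ≤ K ∧ ∀ x ∈ S.level m, S₂.nrm m (T x) ≤ K * S.nrm m x := by
  obtain ⟨K, hK⟩ := hT m
  exact ⟨max K 0, le_max_right _ _, fun x hx => (hK x hx).2.trans
    (mul_le_mul_of_nonneg_right (le_max_left _ _) (hS.nrm_nonneg hx))⟩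

theorem IsScOperator.mem (hT : S.IsScOperator S₂ T) {m : ℕ} {x : V} (hx : x ∈ S.level m) :
    T x ∈ S₂.level m :=
  (hT m).choose_spec x hx |>.1

theorem IsScOperator.comp {U : V₂ →ₗ[ℝ] V₃} (hU : S₂.IsScOperator S₃ U)
    (hT : S.IsScOperator S₂ T) (hS₂ : S₂.IsSc) : S.IsScOperator S₃ (U ∘ₗ T) := fun m => by
  obtain ⟨K, hK0, hK⟩ := hU.bound hS₂ m
  obtain ⟨K', hK'⟩ := hT m
  exact ⟨K * K', fun x hx => ⟨hU.mem (hT.mem hx), (hK _ (hT.mem hx)).trans (by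
    rw [mul_assoc]
    exact mul_le_mul_of_nonneg_left (hK' x hx).2 hK0)⟩⟩

/-- Only subadditivity is assumed of the target, so that this also applies to `S₂.shift 1` without
showing that the shift is an sc-structure. -/
theorem IsScOperator.add (hS₂ : ∀ m, ∀ x ∈ S₂.level m, ∀ y ∈ S₂.level m,
      S₂.nrm m (x + y) ≤ S₂.nrm m x + S₂.nrm m y)
    (hT : S.IsScOperator S₂ T) (hT' : S.IsScOperator S₂ T') : S.IsScOperator S₂ (T + T') :=
  fun m => by
    obtain ⟨K, hK⟩ := hT m
    obtain ⟨K', hK'⟩ := hT' m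
    exact ⟨K + K', fun x hx => ⟨add_mem (hK x hx).1 (hK' x hx).1,
      (hS₂ m _ (hK x hx).1 _ (hK' x hx).1).trans (by
        rw [add_mul]
        exact add_le_add (hK x hx).2 (hK' x hx).2)⟩⟩

theorem IsScOperator.neg (hS₂ : ∀ m, ∀ a : ℝ, ∀ x ∈ S₂.level m,
      S₂.nrm m (a • x) = |a| * S₂.nrm m x)
    (hT : S.IsScOperator S₂ T) : S.IsScOperator S₂ (-T) := fun m => by
  obtain ⟨K, hK⟩ := hT m
  refine ⟨K, fun x hx => ⟨neg_mem (hK x hx).1, ?_⟩⟩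
  have h := hS₂ m (-1) _ (hK x hx).1
  rw [abs_neg, abs_one, one_mul, neg_one_smul] at h
  exact h ▸ (hK x hx).2

/-- A map which gains a level is an sc⁺-operator. -/
theorem isScPlusOperator_of_shift (hS : S.IsSc) (hS₂ : S₂.IsSc)
    (hT : S.IsScOperator (S₂.shift 1) T) : S.IsScPlusOperator S₂ T := by
  refine ⟨fun m => ?_, hT⟩
  obtain ⟨K, hK0, hK⟩ := hS₂.exists_nrm_le (Nat.le_succ m)
  obtain ⟨K', hK'0, hK'⟩ := hT.bound hS m
  exact ⟨K * K', fun x hx => ⟨hS₂.nested m (hT.mem hx), (hK _ (hT.mem hx)).trans (by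
    rw [mul_assoc]
    exact mul_le_mul_of_nonneg_left (hK' x hx) hK0)⟩⟩

theorem IsScPlusOperator.add (hS₂ : S₂.IsSc) (hT : S.IsScPlusOperator S₂ T)
    (hT' : S.IsScPlusOperator S₂ T') : S.IsScPlusOperator S₂ (T + T') :=
  ⟨hT.1.add hS₂.nrm_add hT'.1, hT.2.add (fun m => hS₂.nrm_add (m + 1)) hT'.2⟩

theorem IsScPlusOperator.neg (hS₂ : S₂.IsSc) (hT : S.IsScPlusOperator S₂ T) :
    S.IsScPlusOperator S₂ (-T) :=
  ⟨hT.1.neg hS₂.nrm_smul, hT.2.neg (fun m => hS₂.nrm_smul (m + 1))⟩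

/-- With `comp_right`, the ideal property of sc⁺-operators. It keeps the errors of a parametrix sc⁺
when the operator is perturbed. -/
theorem IsScPlusOperator.comp_left {U : V₂ →ₗ[ℝ] V₃} (hS : S.IsSc) (hS₂ : S₂.IsSc) (hS₃ : S₃.IsSc)
    (hU : S₂.IsScOperator S₃ U) (hT : S.IsScPlusOperator S₂ T) :
    S.IsScPlusOperator S₃ (U ∘ₗ T) :=
  isScPlusOperator_of_shift hS hS₃ fun m => by
    obtain ⟨K, hK0, hK⟩ := hU.bound hS₂ (m + 1)
    obtain ⟨K', hK'⟩ := hT.2 m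
    exact ⟨K * K', fun x hx => ⟨hU.mem (hT.2.mem hx), (hK _ (hT.2.mem hx)).trans (by
      rw [mul_assoc]
      exact mul_le_mul_of_nonneg_left (hK' x hx).2 hK0)⟩⟩

theorem IsScPlusOperator.comp_right {U : V₂ →ₗ[ℝ] V₃} (hS : S.IsSc) (hS₂ : S₂.IsSc) (hS₃ : S₃.IsSc)
    (hU : S₂.IsScPlusOperator S₃ U) (hT : S.IsScOperator S₂ T) :
    S.IsScPlusOperator S₃ (U ∘ₗ T) :=
  isScPlusOperator_of_shift hS hS₃ (hU.2.comp hT hS₂)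

end Operators

end Scale

/-! ## Linear sc-Fredholm theory -/

namespace Scale

section Banach

variable {V : Type*} [NormedAddCommGroup V] [NormedSpace ℝ V] {S : Scale V}
  {V₂ : Type*} [NormedAddCommGroup V₂] [NormedSpace ℝ V₂] {S₂ : Scale V₂}

/-- The operator which an sc-operator induces on the level `0`. -/
noncomputable def IsScOperator.toCLM (h0 : ∀ x, S.nrm 0 x = ‖x‖) (h0₂ : ∀ x, S₂.nrm 0 x = ‖x‖)
    (hS : S.IsSc) {T : V →ₗ[ℝ] V₂} (hT : S.IsScOperator S₂ T) : V →L[ℝ] V₂ :=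
  T.mkContinuous (hT 0).choose fun x => by
    rw [← h0, ← h0₂]
    exact ((hT 0).choose_spec x (hS.mem_zero x)).2

/-- An sc⁺-operator is compact on the level `0`. -/
theorem IsScPlusOperator.isCompactOperator (h0 : ∀ x, S.nrm 0 x = ‖x‖)
    (h0₂ : ∀ x, S₂.nrm 0 x = ‖x‖) (hS : S.IsSc) (hS₂ : S₂.IsSc) {K : V →L[ℝ] V₂}
    (hK : S.IsScPlusOperator S₂ (K : V →ₗ[ℝ] V₂)) : IsCompactOperator K := by
  refine (isCompactOperator_iff_isCompact_closure_image_closedBall (K : V →ₗ[ℝ] V₂) one_pos).2 ?_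
  refine IsSeqCompact.isCompact fun u hu => ?_
  obtain ⟨C, hC0, hC⟩ := hK.2.bound hS 0
  have hmem : ∀ x, K x ∈ S₂.level 1 := fun x => hK.2.mem (hS.mem_zero x)
  -- The compact inclusion controls sequences in the image only; points of its closure are first
  -- approximated up to 1/(i+1) by image points, which are bounded in level 1.
  have hex : ∀ i : ℕ, ∃ x : V, ‖x‖ ≤ 1 ∧ dist (u i) (K x) < 1 / ((i : ℝ) + 1) := fun i => by
    obtain ⟨_, ⟨x, hx, rfl⟩, hd⟩ := Metric.mem_closure_iff.1 (hu i) _ Nat.one_div_pos_of_nat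
    exact ⟨x, by simpa using hx, hd⟩
  choose x hx hd using hex
  obtain ⟨y, -, σ, hσ, hlim⟩ := hS₂.exists_subseq (m := 0) (n := 1) zero_lt_one
    (a := fun i => K (x i)) (K := C) (fun i => hmem _) fun i => by
      refine (hC (x i) (hS.mem_zero _)).trans ?_
      rw [h0]
      exact mul_le_of_le_one_right hC0 (hx i)
  have h1 : Tendsto (fun i => K (x (σ i))) atTop (𝓝 y) := by
    rw [tendsto_iff_norm_sub_tendsto_zero]
    simpa only [h0₂] using hlim
  have h2 : Tendsto (fun i => dist (u (σ i)) (K (x (σ i)))) atTop (𝓝 0) :=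
    squeeze_zero (fun _ => dist_nonneg) (fun i => (hd (σ i)).le)
      (tendsto_one_div_add_atTop_nhds_zero_nat.comp hσ.tendsto_atTop)
  have h3 : Tendsto (fun i => u (σ i)) atTop (𝓝 y) :=
    (tendsto_iff_of_dist h2).2 h1
  exact ⟨y, isClosed_closure.mem_of_tendsto h3 (Eventually.of_forall fun i => hu _), σ, hσ, h3⟩

/-- On a finite dimensional space of smooth points all norms are equivalent. -/
theorem IsSc.exists_nrm_le_of_finiteDimensional (hS : S.IsSc) {N : Submodule ℝ V}
    [FiniteDimensional ℝ N] (hN : N ≤ S.inf) (m : ℕ) :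
    ∃ C, 0 ≤ C ∧ ∀ x ∈ N, S.nrm m x ≤ C * ‖x‖ := by
  let b := Module.finBasis ℝ N
  let c : Fin (Module.finrank ℝ N) → N →L[ℝ] ℝ := fun i =>
    LinearMap.toContinuousLinearMap (b.coord i)
  have hb : ∀ x : N, (x : V) ∈ S.level m := fun x => inf_le_level S m (hN x.2)
  have hsum : ∀ (s : Finset (Fin (Module.finrank ℝ N))) (g : Fin (Module.finrank ℝ N) → ℝ),
      S.nrm m (∑ i ∈ s, g i • (b i : V)) ≤ ∑ i ∈ s, |g i| * S.nrm m (b i) := fun s g => by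
    induction s using Finset.induction_on with
    | empty => simp [hS.nrm_map_zero]
    | insert i s hi ih =>
      rw [Finset.sum_insert hi, Finset.sum_insert hi]
      refine (hS.nrm_add m _ (Submodule.smul_mem _ _ (hb _)) _
        (sum_mem fun j _ => Submodule.smul_mem _ _ (hb _))).trans ?_
      rw [hS.nrm_smul m _ _ (hb _)]
      exact add_le_add le_rfl ih
  refine ⟨∑ i, ‖c i‖ * S.nrm m (b i), Finset.sum_nonneg fun i _ =>
    mul_nonneg (c i).opNorm_nonneg (hS.nrm_nonneg (hb _)), fun x hx => ?_⟩
  have h1 : (x : V) = ∑ i, (b.coord i ⟨x, hx⟩) • (b i : V) := by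
    conv_lhs => rw [← Submodule.coe_mk x hx, ← b.sum_repr ⟨x, hx⟩]
    rw [Submodule.coe_sum]
    rfl
  calc S.nrm m x = S.nrm m (∑ i, (b.coord i ⟨x, hx⟩) • (b i : V)) := by rw [← h1]
    _ ≤ ∑ i, |b.coord i ⟨x, hx⟩| * S.nrm m (b i) := hsum _ _
    _ ≤ ∑ i, ‖c i‖ * S.nrm m (b i) * ‖x‖ := Finset.sum_le_sum fun i _ => by
      have h2 : |b.coord i ⟨x, hx⟩| ≤ ‖c i‖ * ‖x‖ := (c i).le_opNorm ⟨x, hx⟩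
      nlinarith [hS.nrm_nonneg (hb (b i))]
    _ = _ := by rw [Finset.sum_mul]

/-- A topological splitting with a finite dimensional summand of smooth points is an
sc-splitting. -/
theorem IsSc.isScSplitting_of_finiteDimensional (h0 : ∀ x, S.nrm 0 x = ‖x‖) (hS : S.IsSc)
    {N G : Submodule ℝ V} [FiniteDimensional ℝ N] (hN : N ≤ S.inf)
    (h : Submodule.IsTopCompl N G) : S.IsScSplitting N G := by
  let p := N.projectionL G h
  have hpN : ∀ x, p x ∈ N := fun x => Submodule.projectionL_apply_mem h x
  have hp1 : ∀ x ∈ N, p x = x := fun x hx => Submodule.projectionL_apply_left h ⟨x, hx⟩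
  have hp0 : ∀ x ∈ G, p x = 0 := fun x hx => Submodule.projectionL_apply_right h ⟨x, hx⟩
  have hpG : ∀ x, x - p x ∈ G := fun x => by
    rw [← Submodule.projectionL_apply_eq_zero_iff h, map_sub]
    exact sub_eq_zero.2 (hp1 _ (hpN x)).symm
  have hlev : ∀ m x, p x ∈ S.level m := fun m x => inf_le_level S m (hN (hpN x))
  -- The projection is bounded on every level because it factors through level 0: continuity there
  -- is given, and on its range all norms are dominated by the level 0 norm.
  have hbd : ∀ m, ∃ C, 0 ≤ C ∧ ∀ x ∈ S.level m, S.nrm m (p x) ≤ C * S.nrm m x := fun m => by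
    obtain ⟨C, hC0, hC⟩ := hS.exists_nrm_le_of_finiteDimensional hN m
    obtain ⟨C', hC'0, hC'⟩ := hS.exists_nrm_le (Nat.zero_le m)
    refine ⟨C * (‖p‖ * C'), by positivity, fun x hx => (hC _ (hpN x)).trans ?_⟩
    rw [mul_assoc, mul_assoc]
    refine mul_le_mul_of_nonneg_left ((p.le_opNorm x).trans ?_) hC0
    refine mul_le_mul_of_nonneg_left ?_ (norm_nonneg _)
    rw [← h0]
    exact hC' x hx
  have hcl : ∀ F : Submodule ℝ V, IsClosed (F : Set V) →
      ∀ x ∈ S.level 0, (∀ ε > 0, ∃ y ∈ F, S.nrm 0 (x - y) < ε) → x ∈ F := fun F hF x _ hx => by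
    have : x ∈ closure (F : Set V) := Metric.mem_closure_iff.2 fun ε hε => by
      simpa only [h0, dist_eq_norm, SetLike.mem_coe] using hx ε hε
    rwa [hF.closure_eq] at this
  refine ⟨hS.isScSubspace (hcl N h.isClosed) fun m x hx _ ε hε =>
      ⟨x, hx, hN hx, by rwa [sub_self, hS.nrm_map_zero]⟩,
    hS.isScSubspace (hcl G h.symm.isClosed) fun m x hx hxm ε hε => ?_,
    h.isCompl.inf_eq_bot, fun m => le_antisymm (fun x hx => ?_)
      (sup_le inf_le_right inf_le_right), fun m => ?_⟩
  · obtain ⟨C, hC0, hC⟩ := hbd m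
    -- A smooth approximation of x is pushed into G by 1 - p, which preserves smoothness and
    -- enlarges the error at most by the factor 1 + C.
    obtain ⟨y, hy, hlt⟩ := hS.dense m x hxm (ε / (1 + C)) (by positivity)
    have hym := inf_le_level S m hy
    refine ⟨y - p y, hpG y, sub_mem hy (hN (hpN y)), ?_⟩
    have h1 : x - (y - p y) = (x - y) - p (x - y) := by
      rw [map_sub, hp0 x hx]
      abel
    have hxy := sub_mem hxm hym
    rw [h1]
    calc S.nrm m (x - y - p (x - y)) ≤ S.nrm m (x - y) + S.nrm m (p (x - y)) :=
          hS.nrm_sub_le hxy (hlev m _)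
      _ ≤ S.nrm m (x - y) + C * S.nrm m (x - y) := add_le_add le_rfl (hC _ hxy)
      _ = (1 + C) * S.nrm m (x - y) := by ring
      _ < (1 + C) * (ε / (1 + C)) := mul_lt_mul_of_pos_left hlt (by positivity)
      _ = ε := by field_simp
  · refine Submodule.mem_sup.2 ⟨p x, ⟨hpN x, hlev m x⟩, x - p x,
      ⟨hpG x, sub_mem hx (hlev m x)⟩, by abel⟩
  · obtain ⟨C, hC0, hC⟩ := hbd m
    refine ⟨1 + C, fun x hx y hy => ?_⟩
    have hxy : x + y ∈ S.level m := add_mem hx.2 hy.2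
    have h1 : p (x + y) = x := by rw [map_add, hp1 x hx.1, hp0 y hy.1, add_zero]
    have h2 := hC _ hxy
    rw [h1] at h2
    have h3 := hS.nrm_sub_le hxy hx.2
    rw [add_sub_cancel_left] at h3
    have h4 := hS.nrm_nonneg hxy
    exact ⟨by linarith, by linarith⟩

theorem IsScSplitting.symm {V : Type*} [AddCommGroup V] [Module ℝ V] {S : Scale V}
    {F G : Submodule ℝ V} (h : S.IsScSplitting F G) : S.IsScSplitting G F :=
  ⟨h.right, h.left, by rw [inf_comm]; exact h.disjoint,
    fun m => by rw [sup_comm]; exact h.sum m, fun m => by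
      obtain ⟨K, hK⟩ := h.bounded m
      exact ⟨K, fun x hx y hy => by rw [add_comm]; exact (hK y hy x hx).symm⟩⟩

/-- Smooth points span a complement of any closed subspace of finite codimension. -/
theorem IsSc.exists_isCompl_le_inf (h0 : ∀ x, S.nrm 0 x = ‖x‖) (hS : S.IsSc)
    {R : Submodule ℝ V} (hR : IsClosed (R : Set V)) [FiniteDimensional ℝ (V ⧸ R)] :
    ∃ C : Submodule ℝ V, C ≤ S.inf ∧ IsCompl R C := by
  -- This sum is closed, since it contains the closed finite codimensional R, and dense, since
  -- smooth points are dense in level 0. A complement of R ∩ E_∞ within E_∞ is then a complement of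
  -- R.
  have hd : R ⊔ S.inf = ⊤ := by
    have hcl : IsClosed ((R ⊔ S.inf : Submodule ℝ V) : Set V) :=
      Submodule.isClosed_mono_of_finiteDimensional_quotient hR le_sup_left
    refine eq_top_iff.2 fun x _ => ?_
    rw [← SetLike.mem_coe, ← hcl.closure_eq]
    refine Metric.mem_closure_iff.2 fun ε hε => ?_
    obtain ⟨y, hy, hlt⟩ := hS.dense 0 x (hS.mem_zero x) ε hε
    exact ⟨y, Submodule.mem_sup_right hy, by rwa [dist_eq_norm, ← h0]⟩
  obtain ⟨C, hC⟩ := (R.comap S.inf.subtype).exists_isCompl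
  refine ⟨C.map S.inf.subtype, Submodule.map_subtype_le _ _, disjoint_iff.2 ?_,
    codisjoint_iff.2 (eq_top_iff.2 fun x _ => ?_)⟩
  · refine eq_bot_iff.2 ?_
    rintro _ ⟨hx, ⟨y, hy, rfl⟩⟩
    have : y ∈ R.comap S.inf.subtype ⊓ C := ⟨hx, hy⟩
    rw [hC.inf_eq_bot] at this
    rw [(Submodule.mem_bot ℝ).1 this]
    exact zero_mem _
  · have hx : x ∈ R ⊔ S.inf := by rw [hd]; trivial
    obtain ⟨r, hr, y, hy, rfl⟩ := Submodule.mem_sup.1 hx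
    have hy' : (⟨y, hy⟩ : S.inf) ∈ R.comap S.inf.subtype ⊔ C := by rw [hC.sup_eq_top]; trivial
    obtain ⟨a, ha, c, hc, hac⟩ := Submodule.mem_sup.1 hy'
    have : y = (a : V) + c := congrArg Subtype.val hac.symm
    rw [this, ← add_assoc]
    exact Submodule.mem_sup.2 ⟨r + a, add_mem hr ha, c, ⟨c, hc, rfl⟩, rfl⟩

variable [CompleteSpace V] [CompleteSpace V₂]

/-- An sc-operator with a parametrix modulo sc⁺-operators is sc-Fredholm. -/
theorem isScFredholm_of_parametrix (h0 : ∀ x, S.nrm 0 x = ‖x‖) (h0₂ : ∀ x, S₂.nrm 0 x = ‖x‖)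
    (hS : S.IsSc) (hS₂ : S₂.IsSc) {A : V →ₗ[ℝ] V₂} {R : V₂ →ₗ[ℝ] V} {K : V →ₗ[ℝ] V}
    {K₂ : V₂ →ₗ[ℝ] V₂} (hA : S.IsScOperator S₂ A) (hR : S₂.IsScOperator S R)
    (hK : S.IsScPlusOperator S K) (hK₂ : S₂.IsScPlusOperator S₂ K₂)
    (hRA : R ∘ₗ A = LinearMap.id + K) (hAR : A ∘ₗ R = LinearMap.id + K₂) :
    S.IsScFredholm S₂ A ∧ FiniteDimensional ℝ (V₂ ⧸ LinearMap.range A) ∧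
      (R ∘ₗ A).index = 0 := by
  have hRA' : ∀ x, R (A x) = x + K x := fun x => LinearMap.congr_fun hRA x
  -- Regularity bootstrap: in x = R A x - K x the term K x lies one level above x, so x climbs to
  -- the level of R A x, with an estimate.
  have hreg : ∀ m, ∃ C, 0 ≤ C ∧ ∀ x, R (A x) ∈ S.level m → x ∈ S.level m ∧
      S.nrm m x ≤ C * (S.nrm m (R (A x)) + ‖x‖) := fun m => by
    induction m with
    | zero =>
      refine ⟨1, zero_le_one, fun x hx => ⟨hS.mem_zero x, ?_⟩⟩
      rw [h0, one_mul]
      linarith [hS.nrm_nonneg hx]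
    | succ m ih =>
      obtain ⟨C, hC0, hC⟩ := ih
      obtain ⟨D, hD0, hD⟩ := hK.2.bound hS m
      obtain ⟨I, hI0, hI⟩ := hS.exists_nrm_le (Nat.le_succ m)
      refine ⟨1 + D * C * (I + 1), by positivity, fun x hx => ?_⟩
      obtain ⟨h1, h2⟩ := hC x (hS.nested m hx)
      have h3 : K x ∈ S.level (m + 1) := hK.2.mem h1
      have h4 : x = R (A x) - K x := by rw [hRA', add_sub_cancel_right]
      have h5 : S.nrm (m + 1) (K x) ≤ D * S.nrm m x := hD x h1
      have h6 := hI _ hx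
      have h7 := hS.nrm_nonneg hx
      refine ⟨by rw [h4]; exact sub_mem hx h3, ?_⟩
      have h8 : S.nrm (m + 1) x ≤ S.nrm (m + 1) (R (A x)) + S.nrm (m + 1) (K x) := by
        conv_lhs => rw [h4]
        exact hS.nrm_sub_le hx h3
      have h9 : S.nrm m x ≤ C * ((I + 1) * (S.nrm (m + 1) (R (A x)) + ‖x‖)) :=
        h2.trans (mul_le_mul_of_nonneg_left (by nlinarith [norm_nonneg x]) hC0)
      have h10 := mul_le_mul_of_nonneg_left h9 hD0
      nlinarith [norm_nonneg x]
  let A' := hA.toCLM h0 h0₂ hS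
  let K' := hK.1.toCLM h0 h0 hS
  let K₂' := hK₂.1.toCLM h0₂ h0₂ hS₂
  have hKc : IsCompactOperator K' := hK.isCompactOperator (K := K') h0 h0 hS hS
  have hKc₂ : IsCompactOperator K₂' := hK₂.isCompactOperator (K := K₂') h0₂ h0₂ hS₂ hS₂
  obtain ⟨hker, -, hind⟩ := hKc.fredholm_one_add
  obtain ⟨-, hcok, -⟩ := hKc₂.fredholm_one_add
  have e1 : (1 + K' : V →L[ℝ] V).toLinearMap = R ∘ₗ A := hRA.symm
  have e2 : (1 + K₂' : V₂ →L[ℝ] V₂).toLinearMap = A ∘ₗ R := hAR.symm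
  rw [e1] at hker hind
  rw [e2] at hcok
  -- The kernel of A lies in that of R A and the range of A contains that of A R, so both finiteness
  -- statements are inherited.
  have hkerA : FiniteDimensional ℝ (LinearMap.ker A) :=
    Submodule.finiteDimensional_of_le (LinearMap.ker_le_ker_comp A R)
  have hcokA : FiniteDimensional ℝ (V₂ ⧸ LinearMap.range A) :=
    Submodule.CoFG.of_le (LinearMap.range_comp_le_range R A) hcok
  refine ⟨⟨hA, ?_⟩, hcokA, hind⟩
  -- For x in the kernel R A x = 0 lies on all levels, hence so does x.
  have hkerinf : LinearMap.ker A ≤ S.inf := fun x hx => by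
    refine (Submodule.mem_iInf _).2 fun m => ((hreg m).choose_spec.2 x ?_).1
    rw [LinearMap.mem_ker.1 hx, map_zero]
    exact zero_mem _
  obtain ⟨X, hX⟩ :=
    (Submodule.ClosedComplemented.of_finiteDimensional (LinearMap.ker A)).exists_isTopCompl
  have hXc : IsClosed (X : Set V) := hX.symm.isClosed
  have : CompleteSpace X := hXc.completeSpace_coe
  let f : X →L[ℝ] V₂ := A'.comp X.subtypeL
  have hfA : ∀ x : X, f x = A x := fun x => rfl
  have hfker : LinearMap.ker f.toLinearMap = ⊥ := LinearMap.ker_eq_bot'.2 fun x hx => by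
    have : (x : V) ∈ LinearMap.ker A ⊓ X := ⟨hx, x.2⟩
    rw [hX.isCompl.inf_eq_bot] at this
    exact Subtype.ext this
  have hfran : LinearMap.range f.toLinearMap = LinearMap.range A := by
    refine le_antisymm ?_ ?_
    · rintro _ ⟨x, rfl⟩
      exact ⟨x, rfl⟩
    · rintro _ ⟨x, rfl⟩
      have hx : x ∈ LinearMap.ker A ⊔ X := by rw [hX.isCompl.sup_eq_top]; trivial
      obtain ⟨a, ha, b, hb, rfl⟩ := Submodule.mem_sup.1 hx
      exact ⟨⟨b, hb⟩, by simp [hfA, LinearMap.mem_ker.1 ha]⟩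
  have hrc : IsClosed (LinearMap.range A : Set V₂) := by
    obtain ⟨G, hG⟩ := (LinearMap.range A).exists_isCompl
    have hGf : FiniteDimensional ℝ G :=
      ((LinearMap.range A).quotientEquivOfIsCompl G hG).finiteDimensional
    rw [← hfran] at hG ⊢
    exact f.closed_complemented_range_of_isCompl_of_ker_eq_bot G hG G.closed_of_finiteDimensional
      hfker
  obtain ⟨C, hCinf, hC⟩ := hS₂.exists_isCompl_le_inf h0₂ hrc
  have hCf : FiniteDimensional ℝ C :=
    ((LinearMap.range A).quotientEquivOfIsCompl C hC).finiteDimensional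
  have hCt : Submodule.IsTopCompl (LinearMap.range A) C :=
    Submodule.IsCompl.isTopCompl_of_isClosed_of_finiteDimensional hC hrc
  have hfinj : Function.Injective f := LinearMap.ker_eq_bot.1 hfker
  obtain ⟨c, hc⟩ := f.antilipschitz_of_injective_of_isClosed_range hfinj (by
    have : (Set.range f : Set V₂) = LinearMap.range f.toLinearMap := rfl
    rwa [this, hfran])
  have hcb : ∀ x ∈ X, ‖x‖ ≤ c * ‖A x‖ := fun x hx => by
    simpa [hfA] using hc.le_mul_dist ⟨x, hx⟩ 0
  let e : X ≃ₗ[ℝ] LinearMap.range A := (LinearEquiv.ofInjective f.toLinearMap hfinj).trans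
    (LinearEquiv.ofEq _ _ hfran)
  have he : ∀ x : X, (e x : V₂) = A x := fun x => rfl
  refine ⟨X, LinearMap.range A, C, hS.isScSplitting_of_finiteDimensional h0 hkerinf hX,
    (hS₂.isScSplitting_of_finiteDimensional h0₂ hCinf hCt.symm).symm, hkerA, hCf, e, he,
    fun m => ?_, fun m => ?_⟩
  · obtain ⟨D, hD⟩ := hA m
    exact ⟨D, fun x hx => hD x hx⟩
  -- On level m the inverse is bounded by the regularity estimate. Its lower order term ‖x‖ is
  -- absorbed by the level 0 bound below of A on X, which comes from the closed range.
  · obtain ⟨D, hD0, hD⟩ := hreg m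
    obtain ⟨B, hB0, hB⟩ := hR.bound hS₂ m
    obtain ⟨I, hI0, hI⟩ := hS₂.exists_nrm_le (Nat.zero_le m)
    refine ⟨D * (B + c * I), fun y hy => ?_⟩
    obtain ⟨x, rfl⟩ := e.surjective y
    have hy : A x ∈ S₂.level m := hy
    obtain ⟨h1, h2⟩ := hD x (hR.mem hy)
    rw [LinearEquiv.coe_coe, e.symm_apply_apply]
    refine ⟨h1, h2.trans ?_⟩
    rw [mul_assoc]
    refine mul_le_mul_of_nonneg_left ?_ hD0
    have h3 : ‖A x‖ ≤ I * S₂.nrm m (A x) := h0₂ (A x) ▸ hI _ hy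
    have h4 := mul_le_mul_of_nonneg_left h3 c.coe_nonneg
    have h5 := hcb x x.2
    have h6 : R (A x) ∈ S.level m := hR.mem hy
    have h7 := hB _ hy
    change S.nrm m (R (A x)) + ‖(x : V)‖ ≤ (B + c * I) * S₂.nrm m (A x)
    linarith

end Banach

end Scale

namespace Scale

/-! ### Sc-splittings and pulled back scales -/

section Splitting

variable {V : Type*} [AddCommGroup V] [Module ℝ V] {S : Scale V} {F G : Submodule ℝ V}

theorem IsScSplitting.isCompl (h : S.IsScSplitting F G) (h0 : S.level 0 = ⊤) : IsCompl F G :=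
  ⟨disjoint_iff.2 h.disjoint, codisjoint_iff.2 (by simpa [h0] using (h.sum 0).symm)⟩

theorem IsScSplitting.isScOperator_projectionOnto (h : S.IsScSplitting F G) (hc : IsCompl F G) :
    S.IsScOperator (S.restrict F) (F.projectionOnto G hc) := fun m => by
  obtain ⟨K, hK⟩ := h.bounded m
  refine ⟨K, fun x hx => ?_⟩
  rw [h.sum m] at hx
  obtain ⟨a, ha, b, hb, rfl⟩ := Submodule.mem_sup.1 hx
  have h1 : F.projectionOnto G hc (a + b) = ⟨a, ha.1⟩ := by
    rw [map_add, Submodule.projectionOnto_apply_left hc ⟨a, ha.1⟩,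
      Submodule.projectionOnto_apply_right hc ⟨b, hb.1⟩, add_zero]
  rw [h1]
  exact ⟨ha.2, (hK a ha b hb).1⟩

theorem isScOperator_subtype : (S.restrict F).IsScOperator S F.subtype :=
  fun _ => ⟨1, fun _ hx => ⟨hx, (one_mul _).ge⟩⟩

/-- A scale which is pulled back from an sc-structure along an injective map and which has an
sc-splitting is an sc-structure. -/
theorem IsScSplitting.isSc_of_comap {V₂ : Type*} [AddCommGroup V₂] [Module ℝ V₂] {S₂ : Scale V₂}
    {i : V →ₗ[ℝ] V₂} (hS₂ : S₂.IsSc) (hi : Function.Injective i)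
    (h : (comap i S₂).IsScSplitting F G) : (comap i S₂).IsSc := by
  set S := comap i S₂ with hS
  have h0 : S.level 0 = ⊤ := by simp [hS, comap, hS₂.level_zero]
  have hadd : ∀ m, ∀ x ∈ S.level m, ∀ y ∈ S.level m, S.nrm m (x + y) ≤ S.nrm m x + S.nrm m y :=
    fun m x hx y hy => by
      simp only [hS, comap, map_add]
      exact hS₂.nrm_add m _ hx _ hy
  have hnn : ∀ m, ∀ x ∈ S.level m, 0 ≤ S.nrm m x := fun m x hx => hS₂.nrm_nonneg (m := m) hx
  have hcomp := h.isCompl h0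
  let p := F.projectionOnto G hcomp
  let r := G.projectionOnto F hcomp.symm
  have hpr : ∀ x, (p x : V) + r x = x := fun x =>
    Submodule.projection_add_projection_eq_self hcomp x
  have hp := h.isScOperator_projectionOnto hcomp
  have hr := h.symm.isScOperator_projectionOnto hcomp.symm
  -- Both summands are sc-structures by definition of a splitting. Completeness, compactness and
  -- density are obtained componentwise and reassembled.
  have lim : ∀ m (a : ℕ → V) (x y : V), (∀ i, a i ∈ S.level m) → x ∈ F → x ∈ S.level m → y ∈ G →
      y ∈ S.level m → Tendsto (fun i => S.nrm m (p (a i) - x)) atTop (𝓝 0) →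
      Tendsto (fun i => S.nrm m (r (a i) - y)) atTop (𝓝 0) →
      Tendsto (fun i => S.nrm m (a i - (x + y))) atTop (𝓝 0) := fun m a x y ha _ hx _ hy h1 h2 => by
    refine squeeze_zero (fun i => hnn m _ (sub_mem (ha i) (add_mem hx hy))) (fun i => ?_)
      (by simpa using h1.add h2)
    have h3 : a i - (x + y) = (p (a i) - x) + (r (a i) - y) := by
      conv_lhs => rw [← hpr (a i)]
      abel
    rw [h3]
    exact hadd m _ (sub_mem (hp.mem (ha i)) hx) _ (sub_mem (hr.mem (ha i)) hy)
  refine ⟨h0, fun m x hx => hS₂.nested m hx, hadd, fun m a x hx => ?_, fun m x hx hx0 => ?_,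
    fun m a ha hc => ?_, fun m n hmn a ha => ?_, fun m x hx ε hε => ?_⟩
  · simp only [hS, comap, map_smul]
    exact hS₂.nrm_smul m a _ hx
  · exact hi ((hS₂.eq_zero_of_nrm m _ hx hx0).trans (map_zero i).symm)
  · have cauchy : ∀ {F' : Submodule ℝ V} (T : V →ₗ[ℝ] F'), S.IsScOperator (S.restrict F') T →
        ∀ ε > 0, ∃ N, ∀ i ≥ N, ∀ j ≥ N, (S.restrict F').nrm m (T (a i) - T (a j)) < ε := by
      intro F' T hT ε hε
      obtain ⟨K, hK⟩ := hT m
      obtain ⟨N, hN⟩ := hc (ε / (max K 1)) (by positivity)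
      refine ⟨N, fun i hi j hj => ?_⟩
      rw [← map_sub]
      have hd := sub_mem (ha i) (ha j)
      calc _ ≤ K * S.nrm m (a i - a j) := (hK _ hd).2
        _ ≤ max K 1 * S.nrm m (a i - a j) :=
          mul_le_mul_of_nonneg_right (le_max_left _ _) (hnn m _ hd)
        _ < max K 1 * (ε / max K 1) := mul_lt_mul_of_pos_left (hN i hi j hj) (by positivity)
        _ = ε := by field_simp
    obtain ⟨x, hx, hxl⟩ := h.left.2.complete m (fun i => p (a i)) (fun i => hp.mem (ha i))
      (cauchy p hp)
    obtain ⟨y, hy, hyl⟩ := h.right.2.complete m (fun i => r (a i)) (fun i => hr.mem (ha i))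
      (cauchy r hr)
    exact ⟨x + y, add_mem hx hy, lim m a x y ha x.2 hx y.2 hy hxl hyl⟩
  · have bd : ∀ {F' : Submodule ℝ V} (T : V →ₗ[ℝ] F'), S.IsScOperator (S.restrict F') T →
        ∃ K, ∀ i, (S.restrict F').nrm n (T (a i)) ≤ K := by
      intro F' T hT
      obtain ⟨K, hK⟩ := hT n
      refine ⟨max K 0, fun i => (hK _ (ha i).1).2.trans ?_⟩
      have := hnn n _ (ha i).1
      nlinarith [le_max_left K 0, le_max_right K 0, (ha i).2]
    obtain ⟨K, hK⟩ := bd p hp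
    obtain ⟨K', hK'⟩ := bd r hr
    obtain ⟨x, hx, σ, hσ, hxl⟩ := h.left.2.exists_subseq hmn (fun i => hp.mem (ha i).1) hK
    obtain ⟨y, hy, τ, hτ, hyl⟩ := h.right.2.exists_subseq hmn
      (fun i => hr.mem (ha (σ i)).1) fun i => hK' _
    have hle : S.level n ≤ S.level m := fun x hx => hS₂.level_anti hmn.le hx
    exact ⟨x + y, add_mem hx hy, σ ∘ τ, hσ.comp hτ,
      lim m (fun i => a (σ (τ i))) x y (fun i => hle (ha _).1) x.2 hx y.2 hy
        (hxl.comp hτ.tendsto_atTop) hyl⟩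
  · have hinf : ∀ {F' : Submodule ℝ V} {y : F'}, y ∈ (S.restrict F').inf → (y : V) ∈ S.inf :=
      fun {F' y} hy => by
        simp only [inf, Submodule.mem_iInf] at hy ⊢
        exact hy
    obtain ⟨y, hy, hy'⟩ := h.left.2.dense m (p x) (hp.mem hx) (ε / 2) (by positivity)
    obtain ⟨z, hz, hz'⟩ := h.right.2.dense m (r x) (hr.mem hx) (ε / 2) (by positivity)
    refine ⟨y + z, add_mem (hinf hy) (hinf hz), ?_⟩
    have h3 : x - ((y : V) + z) = (p x - y) + (r x - z) := by
      conv_lhs => rw [← hpr x]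
      abel
    rw [h3]
    refine (hadd m _ (sub_mem (hp.mem hx) (inf_le_level S m (hinf hy))) _
      (sub_mem (hr.mem hx) (inf_le_level S m (hinf hz)))).trans_lt ?_
    exact (add_lt_add hy' hz').trans_eq (add_halves ε)

end Splitting

/-! ### Existence of parametrices and sc⁺-perturbations -/

section Banach

variable {V : Type*} [NormedAddCommGroup V] [NormedSpace ℝ V] {S : Scale V}
  {V₂ : Type*} [NormedAddCommGroup V₂] [NormedSpace ℝ V₂] {S₂ : Scale V₂}

/-- Finite dimensional sc-subspaces consist of smooth points. -/
theorem IsScSubspace.le_inf (h0 : ∀ x, S.nrm 0 x = ‖x‖) {N : Submodule ℝ V}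
    [FiniteDimensional ℝ N] (h : S.IsScSubspace N) : N ≤ S.inf := fun x hx => by
  -- The smooth points of N form a dense subspace of N, closed because N is finite dimensional.
  have hcl : IsClosed ((S.restrict N).inf : Set N) := Submodule.closed_of_finiteDimensional _
  have h1 : (⟨x, hx⟩ : N) ∈ (S.restrict N).inf := by
    rw [← SetLike.mem_coe, ← hcl.closure_eq]
    refine Metric.mem_closure_iff.2 fun ε hε => ?_
    obtain ⟨y, hy, hlt⟩ := h.2.dense 0 ⟨x, hx⟩ (h.2.mem_zero _) ε hε
    refine ⟨y, hy, ?_⟩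
    rw [dist_eq_norm, Submodule.coe_norm, ← h0]
    exact hlt
  simp only [inf, Submodule.mem_iInf] at h1 ⊢
  exact h1

/-- The projection onto a finite dimensional summand is an sc⁺-operator. -/
theorem IsScSplitting.isScPlusOperator_projection (h0 : ∀ x, S.nrm 0 x = ‖x‖) (hS : S.IsSc)
    {N G : Submodule ℝ V} [FiniteDimensional ℝ N] (h : S.IsScSplitting N G) (hc : IsCompl N G) :
    S.IsScPlusOperator S (N.projection G hc) :=
  isScPlusOperator_of_shift hS hS fun m => by
    have hN := h.left.le_inf h0
    obtain ⟨C, hC0, hC⟩ := hS.exists_nrm_le_of_finiteDimensional hN (m + 1)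
    obtain ⟨I, hI0, hI⟩ := hS.exists_nrm_le (Nat.zero_le m)
    have hp := h.isScOperator_projectionOnto hc
    obtain ⟨K, hK0, hK⟩ := hp.bound hS 0
    refine ⟨C * (K * I), fun x hx => ?_⟩
    have hmem : N.projection G hc x ∈ N := (N.projectionOnto G hc x).2
    refine ⟨inf_le_level S _ (hN hmem), (hC _ hmem).trans ?_⟩
    rw [mul_assoc, mul_assoc]
    refine mul_le_mul_of_nonneg_left ?_ hC0
    rw [← h0]
    exact (hK x (hS.mem_zero x)).trans (mul_le_mul_of_nonneg_left (hI x hx) hK0)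

/-- An sc-Fredholm operator has a parametrix modulo sc⁺-operators. -/
theorem IsScFredholm.exists_parametrix (h0 : ∀ x, S.nrm 0 x = ‖x‖) (h0₂ : ∀ x, S₂.nrm 0 x = ‖x‖)
    (hS : S.IsSc) (hS₂ : S₂.IsSc) {T : V →ₗ[ℝ] V₂} (hT : S.IsScFredholm S₂ T) :
    ∃ (R : V₂ →ₗ[ℝ] V) (K : V →ₗ[ℝ] V) (K₂ : V₂ →ₗ[ℝ] V₂),
      S₂.IsScOperator S R ∧ S.IsScPlusOperator S K ∧ S₂.IsScPlusOperator S₂ K₂ ∧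
      R ∘ₗ T = LinearMap.id + K ∧ T ∘ₗ R = LinearMap.id + K₂ ∧
      FiniteDimensional ℝ (LinearMap.ker R) ∧ FiniteDimensional ℝ (V ⧸ LinearMap.range R) := by
  obtain ⟨-, X, Y, C, hX, hY, hker, hC, e, he, -, he'⟩ := hT
  have hXc := hX.isCompl hS.level_zero
  have hYc := hY.isCompl hS₂.level_zero
  -- R inverts T from X to Y and vanishes on C. Its errors are minus the projections onto ker T and
  -- C, sc⁺ because these spaces are finite dimensional and consist of smooth points.
  let R : V₂ →ₗ[ℝ] V := X.subtype ∘ₗ e.symm.toLinearMap ∘ₗ Y.projectionOnto C hYc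
  have hRran : LinearMap.range R = X := by
    refine le_antisymm ?_ fun x hx => ⟨e ⟨x, hx⟩, ?_⟩
    · rintro _ ⟨y, rfl⟩
      exact (e.symm (Y.projectionOnto C hYc y)).2
    · simp [R]
  have hRker : LinearMap.ker R = C := by
    ext y
    simp [R]
  refine ⟨R, -(LinearMap.ker T).projection X hXc, -C.projection Y hYc.symm,
    isScOperator_subtype.comp (he'.comp (hY.isScOperator_projectionOnto hYc) hY.left.2) hX.right.2,
    (hX.isScPlusOperator_projection h0 hS hXc).neg hS,
    (hY.symm.isScPlusOperator_projection h0₂ hS₂ hYc.symm).neg hS₂, ?_, ?_, ?_, ?_⟩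
  · refine LinearMap.ext_on_codisjoint hXc.codisjoint (fun x hx => ?_) fun x hx => ?_
    · simp [LinearMap.mem_ker.1 hx, Submodule.projection_apply_of_mem_left hXc hx]
    · have h1 : Y.projectionOnto C hYc (T x) = e ⟨x, hx⟩ := by
        rw [← he ⟨x, hx⟩, Submodule.projectionOnto_apply_left]
      simp [R, h1, Submodule.projection_apply_of_mem_right hXc hx]
  · have hTR : ∀ y, T (R y) = Y.projectionOnto C hYc y := fun y => by
      simp only [R, LinearMap.comp_apply, Submodule.subtype_apply, LinearEquiv.coe_coe]
      rw [← he, LinearEquiv.apply_symm_apply]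
    refine LinearMap.ext_on_codisjoint hYc.codisjoint (fun y hy => ?_) fun y hy => ?_
    · rw [LinearMap.comp_apply, hTR, Submodule.projectionOnto_apply_left hYc ⟨y, hy⟩]
      simp [Submodule.projection_apply_of_mem_right hYc.symm hy]
    · rw [LinearMap.comp_apply, hTR, Submodule.projectionOnto_apply_right hYc ⟨y, hy⟩]
      simp [Submodule.projection_apply_of_mem_left hYc.symm hy]
  · rw [hRker]
    exact hC
  · rw [hRran]
    exact (X.quotientEquivOfIsCompl _ hXc.symm).symm.finiteDimensional

/-- The parametrix R of T also inverts T + P, with errors K + R P and K₂ + P R. Both ind T + ind R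
and ind (T + P) + ind R are therefore 0. -/
theorem IsScFredholm.add_scPlus_of_norm [CompleteSpace V] [CompleteSpace V₂]
    (h0 : ∀ x, S.nrm 0 x = ‖x‖) (h0₂ : ∀ x, S₂.nrm 0 x = ‖x‖)
    (hS : S.IsSc) (hS₂ : S₂.IsSc) {T P : V →ₗ[ℝ] V₂} (hT : S.IsScFredholm S₂ T)
    (hP : S.IsScPlusOperator S₂ P) :
    S.IsScFredholm S₂ (T + P) ∧ fredholmIndex (T + P) = fredholmIndex T := by
  obtain ⟨R, K, K₂, hR, hK, hK₂, hRT, hTR, hRk, hRc⟩ := hT.exists_parametrix h0 h0₂ hS hS₂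
  obtain ⟨-, hTc, hTi⟩ := isScFredholm_of_parametrix h0 h0₂ hS hS₂ hT.1 hR hK hK₂ hRT hTR
  obtain ⟨hA, hAc, hAi⟩ := isScFredholm_of_parametrix h0 h0₂ hS hS₂ (A := T + P) (R := R)
    (K := K + R ∘ₗ P) (K₂ := K₂ + P ∘ₗ R) (hT.1.add hS₂.nrm_add hP.1) hR
    (hK.add hS (hP.comp_left hS hS₂ hS hR)) (hK₂.add hS₂ (hP.comp_right hS₂ hS hS₂ hR))
    (by rw [LinearMap.comp_add, hRT, add_assoc]) (by rw [LinearMap.add_comp, hTR, add_assoc])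
  refine ⟨hA, ?_⟩
  obtain ⟨-, -, -, -, -, -, hTk, -⟩ := hT
  have hAk : FiniteDimensional ℝ (LinearMap.ker (T + P)) := by
    obtain ⟨-, -, -, -, -, -, h, -⟩ := hA
    exact h
  -- Additivity of the index needs finite dimensional kernels and cokernels of both factors; those
  -- of R come from the parametrix construction.
  have h1 := LinearMap.index_comp (f := T) R
  have h2 := LinearMap.index_comp (f := T + P) R
  have h3 : (T + P).index = T.index := by linarith
  exact h3

end Banach

/-! ### Passage from Banach spaces to vector spaces with a scale -/

section

variable {V : Type*} [AddCommGroup V] [Module ℝ V] {S : Scale V}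

/-- The scales of T_qX and Y_q are pulled back from a chart. Taking the norm of their level 0 as the
Banach norm puts them into the setting of the perturbation result. -/
theorem IsSc.normedSpaceCore (hS : S.IsSc) :
    @NormedSpace.Core ℝ V _ _ _ ⟨S.nrm 0⟩ :=
  let _ : Norm V := ⟨S.nrm 0⟩
  { norm_nonneg := fun x => hS.nrm_nonneg (hS.mem_zero x)
    norm_smul := fun a x => hS.nrm_smul 0 a x (hS.mem_zero x)
    norm_triangle := fun x y => hS.nrm_add 0 x (hS.mem_zero x) y (hS.mem_zero y)
    norm_eq_zero_iff := fun x => ⟨hS.eq_zero_of_nrm 0 x (hS.mem_zero x), fun h => by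
      subst h
      exact hS.nrm_map_zero 0⟩ }

/-- The norm of the level `0`. -/
noncomputable abbrev IsSc.normedAddCommGroup (hS : S.IsSc) : NormedAddCommGroup V :=
  let _ : Norm V := ⟨S.nrm 0⟩
  NormedAddCommGroup.ofCore hS.normedSpaceCore

noncomputable abbrev IsSc.normedSpace (hS : S.IsSc) :
    @NormedSpace ℝ V _ hS.normedAddCommGroup.toSeminormedAddCommGroup :=
  let _ := hS.normedAddCommGroup
  NormedSpace.ofCore hS.normedSpaceCore

theorem IsSc.completeSpace (hS : S.IsSc) :
    @CompleteSpace V hS.normedAddCommGroup.toUniformSpace := by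
  let _ := hS.normedAddCommGroup
  refine Metric.complete_of_cauchySeq_tendsto fun a ha => ?_
  obtain ⟨x, -, hx⟩ := hS.complete 0 a (fun i => hS.mem_zero _) fun ε hε => by
    obtain ⟨N, hN⟩ := Metric.cauchySeq_iff.1 ha ε hε
    exact ⟨N, fun i hi j hj => by
      have := hN i hi j hj
      rwa [dist_eq_norm] at this⟩
  exact ⟨x, tendsto_iff_norm_sub_tendsto_zero.2 hx⟩

/-- An sc-Fredholm operator stays sc-Fredholm, with the same index, when an sc⁺-operator is added
to it. -/
theorem IsScFredholm.add_scPlus {V₂ : Type*} [AddCommGroup V₂] [Module ℝ V₂] {S₂ : Scale V₂}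
    (hS : S.IsSc) (hS₂ : S₂.IsSc) {T P : V →ₗ[ℝ] V₂} (hT : S.IsScFredholm S₂ T)
    (hP : S.IsScPlusOperator S₂ P) :
    S.IsScFredholm S₂ (T + P) ∧ fredholmIndex (T + P) = fredholmIndex T := by
  let _ := hS.normedAddCommGroup
  let _ := hS.normedSpace
  let _ := hS₂.normedAddCommGroup
  let _ := hS₂.normedSpace
  have := hS.completeSpace
  have := hS₂.completeSpace
  exact IsScFredholm.add_scPlus_of_norm (fun _ => rfl) (fun _ => rfl) hS hS₂ hT hP

end

end Scale

/-! ## Sc-calculus -/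

section ScCalculus

variable {V : Type*} [AddCommGroup V] [Module ℝ V] {V₁ : Type*} [AddCommGroup V₁] [Module ℝ V₁]
  {V₂ : Type*} [AddCommGroup V₂] [Module ℝ V₂]
  {S : Scale V} {S₁ : Scale V₁} {S₂ : Scale V₂} {Q D D' : Set V} {x : V}

/-- `D` is a relatively open subset of `Q` for the norm of the level `0`. -/
structure IsScRelOpen (S : Scale V) (Q D : Set V) : Prop where
  subset : D ⊆ Q
  exists_ball : ∀ x ∈ D, ∃ δ > 0, ∀ y ∈ Q, S.nrm 0 (y - x) < δ → y ∈ D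

/-- A convex cone whose points in the level `1` span the level `1`. -/
structure IsScCone (S : Scale V) (Q : Set V) : Prop where
  add_mem : ∀ x ∈ Q, ∀ y ∈ Q, x + y ∈ Q
  smul_mem : ∀ a : ℝ, 0 ≤ a → ∀ x ∈ Q, a • x ∈ Q
  exists_sub : ∀ h ∈ S.level 1, ∃ a ∈ Q, ∃ b ∈ Q, a ∈ S.level 1 ∧ b ∈ S.level 1 ∧ h = a - b

namespace HasScDerivAt

theorem bound {f : V → V₂} {A : V →ₗ[ℝ] V₂} (hS : S.IsSc) (h : HasScDerivAt S S₂ D f x A) :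
    ∃ K, 0 ≤ K ∧ ∀ v, S₂.nrm 0 (A v) ≤ K * S.nrm 0 v := by
  obtain ⟨K, hK⟩ := h.1
  exact ⟨max K 0, le_max_right _ _, fun v => (hK v (hS.mem_zero v)).2.trans
    (mul_le_mul_of_nonneg_right (le_max_left _ _) (hS.nrm_nonneg (hS.mem_zero v)))⟩

theorem mono {f : V → V₂} {A : V →ₗ[ℝ] V₂} (h : HasScDerivAt S S₂ D f x A) (hD : D' ⊆ D) :
    HasScDerivAt S S₂ D' f x A :=
  ⟨h.1, fun ε hε => (h.2 ε hε).imp fun _ hδ => ⟨hδ.1, fun v hv hvD => hδ.2 v hv (hD hvD)⟩⟩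

theorem congr {f g : V → V₂} {A : V →ₗ[ℝ] V₂} (h : HasScDerivAt S S₂ D f x A) (hx : x ∈ D)
    (hfg : ∀ y ∈ D, f y = g y) : HasScDerivAt S S₂ D g x A :=
  ⟨h.1, fun ε hε => (h.2 ε hε).imp fun _ hδ => ⟨hδ.1, fun v hv hvD hlt => by
    rw [← hfg _ hvD, ← hfg _ hx]
    exact hδ.2 v hv hvD hlt⟩⟩

/-- The linearization is local. -/
theorem of_isScRelOpen {f : V → V₂} {A : V →ₗ[ℝ] V₂} (hS : S.IsSc)
    (h : HasScDerivAt S S₂ D' f x A) (hx : x ∈ D') (hD' : IsScRelOpen S Q D') (hD : D ⊆ Q) :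
    HasScDerivAt S S₂ D f x A := by
  refine ⟨h.1, fun ε hε => ?_⟩
  obtain ⟨δ, hδ, hlin⟩ := h.2 ε hε
  obtain ⟨η, hη, hball⟩ := hD'.exists_ball x hx
  obtain ⟨K, hK0, hK⟩ := hS.exists_nrm_le (Nat.zero_le 1)
  refine ⟨min δ (η / (K + 1)), by positivity, fun v hv hvD hlt => ?_⟩
  refine hlin v hv (hball _ (hD hvD) ?_) (hlt.trans_le (min_le_left _ _))
  rw [add_sub_cancel_left]
  have h1 : S.nrm 1 v < η / (K + 1) := hlt.trans_le (min_le_right _ _)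
  rw [lt_div_iff₀ (by positivity)] at h1
  have h2 := hS.nrm_nonneg hv
  nlinarith [hK v hv]

theorem sub {f g : V → V₂} {A B : V →ₗ[ℝ] V₂} (hS₂ : S₂.IsSc) (hf : HasScDerivAt S S₂ D f x A)
    (hg : HasScDerivAt S S₂ D g x B) : HasScDerivAt S S₂ D (f - g) x (A - B) := by
  refine ⟨?_, fun ε hε => ?_⟩
  · obtain ⟨K, hK⟩ := hf.1
    obtain ⟨K', hK'⟩ := hg.1
    refine ⟨K + K', fun v hv => ⟨hS₂.mem_zero _, ?_⟩⟩
    rw [add_mul]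
    exact (hS₂.nrm_sub_le (hS₂.mem_zero _) (hS₂.mem_zero _)).trans
      (add_le_add (hK v hv).2 (hK' v hv).2)
  · obtain ⟨δ, hδ, h1⟩ := hf.2 (ε / 2) (half_pos hε)
    obtain ⟨δ', hδ', h2⟩ := hg.2 (ε / 2) (half_pos hε)
    refine ⟨min δ δ', lt_min hδ hδ', fun v hv hvD hlt => ?_⟩
    have h3 : (f - g) (x + v) - (f - g) x - (A - B) v =
        (f (x + v) - f x - A v) - (g (x + v) - g x - B v) := by
      simp only [Pi.sub_apply, LinearMap.sub_apply]
      abel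
    rw [h3]
    have h4 := hS₂.nrm_sub_le (hS₂.mem_zero (f (x + v) - f x - A v))
      (hS₂.mem_zero (g (x + v) - g x - B v))
    have h5 := h1 v hv hvD (hlt.trans_le (min_le_left _ _))
    have h6 := h2 v hv hvD (hlt.trans_le (min_le_right _ _))
    linarith

/-- The linearization is unique on relatively open subsets of cones which span. -/
theorem unique {f : V → V₂} {A B : V →ₗ[ℝ] V₂} (hS : S.IsSc) (hS₂ : S₂.IsSc) (hQ : IsScCone S Q)
    (hD : IsScRelOpen S Q D) (hx : x ∈ D) (hA : HasScDerivAt S S₂ D f x A)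
    (hB : HasScDerivAt S S₂ D f x B) : A = B := by
  -- Agreement is proved on level 1 vectors of the cone, along the rays x + t v, then on level 1 by
  -- differences, then on all of E_0 by density and boundedness.
  have hcone : ∀ v ∈ Q, v ∈ S.level 1 → A v = B v := fun v hvQ hv => by
    have hn := hS.nrm_nonneg hv
    have hn0 := hS.nrm_nonneg (hS.mem_zero v)
    have key : ∀ ε > 0, S₂.nrm 0 (A v - B v) ≤ ε * (2 * S.nrm 1 v) := fun ε hε => by
      obtain ⟨δ, hδ, h1⟩ := hA.2 ε hε
      obtain ⟨δ', hδ', h2⟩ := hB.2 ε hε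
      obtain ⟨η, hη, h3⟩ := hD.exists_ball x hx
      set t := min (min δ δ' / (S.nrm 1 v + 1)) (η / (S.nrm 0 v + 1)) with ht
      have htp : 0 < t := by positivity
      have ht1 : t * S.nrm 1 v < min δ δ' := by
        have : t ≤ min δ δ' / (S.nrm 1 v + 1) := min_le_left _ _
        rw [le_div_iff₀ (by positivity)] at this
        nlinarith
      have ht2 : t * S.nrm 0 v < η := by
        have : t ≤ η / (S.nrm 0 v + 1) := min_le_right _ _
        rw [le_div_iff₀ (by positivity)] at this
        nlinarith
      have hmem : x + t • v ∈ D := h3 _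
        (hQ.add_mem _ (hD.subset hx) _ (hQ.smul_mem _ htp.le _ hvQ)) (by
          rwa [add_sub_cancel_left, hS.nrm_smul 0 _ _ (hS.mem_zero v), abs_of_pos htp])
      have htv := Submodule.smul_mem _ t hv
      have hnt : S.nrm 1 (t • v) = t * S.nrm 1 v := by
        rw [hS.nrm_smul 1 _ _ hv, abs_of_pos htp]
      have h4 := h1 _ htv hmem (by rw [hnt]; exact ht1.trans_le (min_le_left _ _))
      have h5 := h2 _ htv hmem (by rw [hnt]; exact ht1.trans_le (min_le_right _ _))
      have h6 := hS₂.nrm_sub_le (hS₂.mem_zero (f (x + t • v) - f x - B (t • v)))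
        (hS₂.mem_zero (f (x + t • v) - f x - A (t • v)))
      rw [show f (x + t • v) - f x - B (t • v) - (f (x + t • v) - f x - A (t • v)) =
        t • (A v - B v) by rw [map_smul, map_smul, smul_sub]; abel,
        hS₂.nrm_smul 0 _ _ (hS₂.mem_zero _), abs_of_pos htp] at h6
      rw [hnt] at h4 h5
      have h7 : t * S₂.nrm 0 (A v - B v) ≤ t * (ε * (2 * S.nrm 1 v)) := by linarith
      exact le_of_mul_le_mul_left h7 htp
    refine sub_eq_zero.1 (hS₂.eq_zero_of_nrm 0 _ (hS₂.mem_zero _) (le_antisymm ?_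
      (hS₂.nrm_nonneg (hS₂.mem_zero _))))
    refine le_of_forall_pos_le_add fun ε hε => ?_
    have := key (ε / (2 * S.nrm 1 v + 1)) (by positivity)
    rw [zero_add]
    refine this.trans ?_
    rw [div_mul_eq_mul_div, div_le_iff₀ (by positivity)]
    nlinarith
  have h1 : ∀ v ∈ S.level 1, A v = B v := fun v hv => by
    obtain ⟨a, ha, b, hb, ha1, hb1, rfl⟩ := hQ.exists_sub v hv
    rw [map_sub, map_sub, hcone a ha ha1, hcone b hb hb1]
  obtain ⟨K, hK0, hK⟩ := hA.bound hS
  obtain ⟨K', hK'0, hK'⟩ := hB.bound hS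
  ext v
  refine sub_eq_zero.1 (hS₂.eq_zero_of_nrm 0 _ (hS₂.mem_zero _) (le_antisymm ?_
    (hS₂.nrm_nonneg (hS₂.mem_zero _))))
  refine le_of_forall_pos_le_add fun ε hε => ?_
  obtain ⟨y, hy, hlt⟩ := hS.dense 0 v (hS.mem_zero v) (ε / (K + K' + 1)) (by positivity)
  have h2 : A v - B v = A (v - y) - B (v - y) := by
    rw [map_sub, map_sub, h1 y (Scale.inf_le_level S 1 hy)]
    abel
  rw [h2, zero_add]
  have h3 := hS₂.nrm_sub_le (hS₂.mem_zero (A (v - y))) (hS₂.mem_zero (B (v - y)))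
  have h4 := hK (v - y)
  have h5 := hK' (v - y)
  rw [lt_div_iff₀ (by positivity)] at hlt
  nlinarith [hS.nrm_nonneg (hS.mem_zero (v - y))]

theorem scDeriv_eq {f : V → V₂} {A : V →ₗ[ℝ] V₂} (hS : S.IsSc) (hS₂ : S₂.IsSc)
    (hQ : IsScCone S Q) (hD : IsScRelOpen S Q D) (hx : x ∈ D) (hA : HasScDerivAt S S₂ D f x A) :
    scDeriv S S₂ D f x = A := by
  have hex : ∃ A, HasScDerivAt S S₂ D f x A := ⟨A, hA⟩
  rw [scDeriv, dif_pos hex]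
  exact unique hS hS₂ hQ hD hx hex.choose_spec hA

/-- A linearization for `F^1` is a linearization for `F`. -/
theorem of_shift {f : V → V₂} {A : V →ₗ[ℝ] V₂} (hS : S.IsSc) (hS₂ : S₂.IsSc)
    (hf : ∀ y ∈ D, f y ∈ S₂.level 1) (hx : x ∈ D) (hA : HasScDerivAt S (S₂.shift 1) D f x A) :
    HasScDerivAt S S₂ D f x A := by
  obtain ⟨I, hI0, hI⟩ := hS₂.exists_nrm_le (Nat.zero_le 1)
  obtain ⟨K, hK⟩ := hA.1
  have hA1 : ∀ v, A v ∈ S₂.level 1 := fun v => (hK v (hS.mem_zero v)).1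
  refine ⟨⟨I * K, fun v hv => ⟨hS₂.mem_zero _, (hI _ (hA1 v)).trans ?_⟩⟩, fun ε hε => ?_⟩
  · rw [mul_assoc]
    exact mul_le_mul_of_nonneg_left (hK v hv).2 hI0
  · obtain ⟨δ, hδ, h⟩ := hA.2 (ε / (I + 1)) (by positivity)
    refine ⟨δ, hδ, fun v hv hvD hlt =>
      (hI _ (sub_mem (sub_mem (hf _ hvD) (hf _ hx)) (hA1 v))).trans ?_⟩
    have h1 : S₂.nrm 1 (f (x + v) - f x - A v) ≤ ε / (I + 1) * S.nrm 1 v := h v hv hvD hlt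
    refine (mul_le_mul_of_nonneg_left h1 hI0).trans ?_
    rw [← mul_assoc]
    refine mul_le_mul_of_nonneg_right ?_ (hS.nrm_nonneg hv)
    rw [mul_div_assoc', div_le_iff₀ (by positivity)]
    nlinarith

end HasScDerivAt

/-! ### Families of linear maps -/

/-- A family `L y` of linear maps, `y ∈ D`, and a bounded linear map `L₀`, such that
`(y, k) ↦ L y k` tends to `L₀ k₀` as `ρ y → 0` and `k → k₀` in the level `0`. -/
structure IsScFamily {P : Type*} (S : Scale V) (S₂ : Scale V₂) (D : Set P) (ρ : P → ℝ)
    (L : P → V → V₂) (L₀ : V →ₗ[ℝ] V₂) : Prop where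
  isLinearMap : ∀ y ∈ D, IsLinearMap ℝ (L y)
  bound : ∃ K, 0 ≤ K ∧ ∀ k, S₂.nrm 0 (L₀ k) ≤ K * S.nrm 0 k
  continuous : ∀ k₀, ∀ ε > 0, ∃ δ > 0, ∀ y ∈ D, ρ y < δ → ∀ k, S.nrm 0 (k - k₀) < δ →
    S₂.nrm 0 (L y k - L₀ k₀) < ε

namespace IsScFamily

variable {P : Type*} {E : Set P} {ρ : P → ℝ} {L : P → V₁ → V₂} {L₀ : V₁ →ₗ[ℝ] V₂}

/-- Joint continuity at k₀ = 0 bounds L y on a ball whose radius is the same for all y near the base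
point; linearity turns this into a uniform operator bound. -/
theorem exists_bound (hS₁ : S₁.IsSc) (hS₂ : S₂.IsSc) (h : IsScFamily S₁ S₂ E ρ L L₀) :
    ∃ δ > 0, ∃ C, 0 ≤ C ∧ ∀ y ∈ E, ρ y < δ → ∀ k, S₂.nrm 0 (L y k) ≤ C * S₁.nrm 0 k := by
  obtain ⟨δ, hδ, h1⟩ := h.continuous 0 1 one_pos
  refine ⟨δ, hδ, 2 / δ, by positivity, fun y hy hρ k => ?_⟩
  refine (hS₁.exists_bound_of_ball hS₂ (h.isLinearMap y hy) hδ (fun k hk hlt =>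
    ⟨hS₂.mem_zero _, ?_⟩) k (hS₁.mem_zero k)).2
  have := h1 y hy hρ k (by rwa [sub_zero])
  rw [map_zero, sub_zero] at this
  exact this.le

/-- By compactness of the inclusion of the level `1`, the convergence is uniform on bounded subsets
of the level `1`. -/
theorem uniform (hS : S.IsSc) (hS₂ : S₂.IsSc) (h : IsScFamily S₁ S₂ E ρ L L₀)
    {A : V →ₗ[ℝ] V₁} {K : ℝ} (hA : ∀ v, S₁.nrm 0 (A v) ≤ K * S.nrm 0 v)
    {ε : ℝ} (hε : 0 < ε) :
    ∃ δ > 0, ∀ y ∈ E, ρ y < δ → ∀ v ∈ S.level 1,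
      S₂.nrm 0 (L y (A v) - L₀ (A v)) ≤ ε * S.nrm 1 v := by
  by_contra! hcon
  choose y hyE hyρ v hv hlt using fun n : ℕ => hcon (1 / ((n : ℝ) + 1)) Nat.one_div_pos_of_nat
  have hv0 : ∀ n, v n ≠ 0 := fun n h0 => by
    have := hlt n
    rw [h0, hS.nrm_map_zero, map_zero, map_zero, (h.isLinearMap _ (hyE n)).map_zero, sub_zero,
      hS₂.nrm_map_zero, mul_zero] at this
    exact lt_irrefl _ this
  have hp : ∀ n, 0 < S.nrm 1 (v n) := fun n => hS.nrm_pos (hv n) (hv0 n)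
  obtain ⟨g, -, σ, hσ, hlim⟩ := hS.compact 0 1 zero_lt_one (fun n => (S.nrm 1 (v n))⁻¹ • v n)
    fun n => ⟨Submodule.smul_mem _ _ (hv n), by
      rw [hS.nrm_smul 1 _ _ (hv n), abs_of_pos (inv_pos.2 (hp n)), inv_mul_cancel₀ (hp n).ne']⟩
  set a : ℕ → V := fun n => (S.nrm 1 (v n))⁻¹ • v n with ha
  have hlt' : ∀ n, ε < S₂.nrm 0 (L (y n) (A (a n)) - L₀ (A (a n))) := fun n => by
    have h1 : L (y n) (A (a n)) - L₀ (A (a n)) =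
        (S.nrm 1 (v n))⁻¹ • (L (y n) (A (v n)) - L₀ (A (v n))) := by
      rw [ha, map_smul, map_smul, (h.isLinearMap _ (hyE n)).map_smul, smul_sub]
    rw [h1, hS₂.nrm_smul 0 _ _ (hS₂.mem_zero _), abs_of_pos (inv_pos.2 (hp n)), inv_mul_eq_div,
      lt_div_iff₀ (hp n)]
    exact hlt n
  -- Along the subsequence the unit vectors a n of level 1 converge to g in level 0. Then L (y n) (A
  -- (a n)) and L₀ (A (a n)) both approach L₀ (A g), and each is eventually within ε / 2 of it.
  obtain ⟨δ, hδ, hc⟩ := h.continuous (A g) (ε / 2) (half_pos hε)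
  obtain ⟨K₀, hK₀0, hK₀⟩ := h.bound
  have e1 : ∀ᶠ n in atTop, K * S.nrm 0 (a (σ n) - g) < δ :=
    (hlim.const_mul K).eventually (gt_mem_nhds (by rwa [mul_zero]))
  have e2 : ∀ᶠ n in atTop, K₀ * (K * S.nrm 0 (a (σ n) - g)) < ε / 2 :=
    ((hlim.const_mul K).const_mul K₀).eventually (gt_mem_nhds (by
      rw [mul_zero, mul_zero]
      exact half_pos hε))
  have e3 : ∀ᶠ n in atTop, 1 / (((σ n : ℕ) : ℝ) + 1) < δ :=
    (tendsto_one_div_add_atTop_nhds_zero_nat.comp hσ.tendsto_atTop).eventually (gt_mem_nhds hδ)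
  obtain ⟨n, h1, h2, h3⟩ := (e1.and (e2.and e3)).exists
  have h4 : S₁.nrm 0 (A (a (σ n)) - A g) ≤ K * S.nrm 0 (a (σ n) - g) := by
    rw [← map_sub]
    exact hA _
  have h5 := hc (y (σ n)) (hyE _) ((hyρ _).trans h3) (A (a (σ n))) (h4.trans_lt h1)
  have h6 : S₂.nrm 0 (L₀ (A (a (σ n))) - L₀ (A g)) < ε / 2 := by
    rw [← map_sub]
    exact ((hK₀ _).trans (mul_le_mul_of_nonneg_left h4 hK₀0)).trans_lt h2
  have h7 := hS₂.nrm_sub_le (hS₂.mem_zero (L (y (σ n)) (A (a (σ n))) - L₀ (A g)))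
    (hS₂.mem_zero (L₀ (A (a (σ n))) - L₀ (A g)))
  rw [sub_sub_sub_cancel_right] at h7
  linarith [hlt' (σ n)]

/-- The linearization of `y ↦ L y (g y)` at a zero of `g`. -/
theorem hasScDerivAt {L : V → V₁ → V₂} (hS : S.IsSc) (hS₁ : S₁.IsSc) (hS₂ : S₂.IsSc)
    (h : IsScFamily S₁ S₂ D (fun y => S.nrm 0 (y - x)) L L₀) (hx : x ∈ D) {g : V → V₁}
    {A : V →ₗ[ℝ] V₁} (hg : HasScDerivAt S S₁ D g x A) (hgx : g x = 0) :
    HasScDerivAt S S₂ D (fun y => L y (g y)) x (L₀ ∘ₗ A) := by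
  obtain ⟨K, hK0, hK⟩ := hg.bound hS
  obtain ⟨K₀, hK₀0, hK₀⟩ := h.bound
  refine ⟨⟨K₀ * K, fun v hv => ⟨hS₂.mem_zero _, (hK₀ _).trans ?_⟩⟩, fun ε hε => ?_⟩
  · rw [mul_assoc]
    exact mul_le_mul_of_nonneg_left (hK v) hK₀0
  obtain ⟨δ₁, hδ₁, C, hC0, hC⟩ := h.exists_bound hS₁ hS₂
  obtain ⟨δ₂, hδ₂, hu⟩ := h.uniform hS hS₂ hK (half_pos hε)
  obtain ⟨δ₃, hδ₃, hr⟩ := hg.2 (ε / (2 * (C + 1))) (by positivity)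
  obtain ⟨I, hI0, hI⟩ := hS.exists_nrm_le (Nat.zero_le 1)
  refine ⟨min δ₃ (min δ₁ δ₂ / (I + 1)), by positivity, fun v hv hvD hlt => ?_⟩
  have hn := hS.nrm_nonneg hv
  have h0 : S.nrm 0 (x + v - x) < min δ₁ δ₂ := by
    rw [add_sub_cancel_left]
    have h1 : S.nrm 1 v < min δ₁ δ₂ / (I + 1) := hlt.trans_le (min_le_right _ _)
    rw [lt_div_iff₀ (by positivity)] at h1
    nlinarith [hI v hv]
  have h1 := hr v hv hvD (hlt.trans_le (min_le_left _ _))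
  rw [hgx, sub_zero] at h1
  have hlin := h.isLinearMap _ hvD
  have h2 := hC _ hvD (h0.trans_le (min_le_left _ _)) (g (x + v) - A v)
  have h3 := hu _ hvD (h0.trans_le (min_le_right _ _)) v hv
  -- The remainder of g is handled by the local operator bound, the main term by uniform
  -- convergence. Since g x = 0, no derivative of L appears, and `L x` need not equal `L₀`.
  have h4 : L (x + v) (g (x + v)) - L x (g x) - (L₀ ∘ₗ A) v =
      L (x + v) (g (x + v) - A v) + (L (x + v) (A v) - L₀ (A v)) := by
    rw [hlin.map_sub, hgx, (h.isLinearMap _ hx).map_zero, sub_zero, LinearMap.comp_apply]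
    abel
  change S₂.nrm 0 (L (x + v) (g (x + v)) - L x (g x) - (L₀ ∘ₗ A) v) ≤ _
  rw [h4]
  have h5 := hS₂.nrm_add 0 _ (hS₂.mem_zero (L (x + v) (g (x + v) - A v))) _
    (hS₂.mem_zero (L (x + v) (A v) - L₀ (A v)))
  have h6 : C * (ε / (2 * (C + 1)) * S.nrm 1 v) ≤ ε / 2 * S.nrm 1 v := by
    rw [← mul_assoc]
    refine mul_le_mul_of_nonneg_right ?_ hn
    rw [mul_div_assoc', div_le_div_iff₀ (by positivity) (by positivity)]
    nlinarith
  have h7 := mul_le_mul_of_nonneg_left h1 hC0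
  linarith

end IsScFamily

/-! ### Maps of class sc¹ -/

/-- The linearizations of a map of class sc¹ form a continuous family. -/
theorem isScFamily_of_tangent {f : V → V₂} {Df : V → V →ₗ[ℝ] V₂} (hS : S.IsSc)
    (hf : ∀ y ∈ D, y ∈ S.level 1 → HasScDerivAt S S₂ D f y (Df y))
    (hT : IsScZero S.tangent S₂.tangent (tangentDomain S D) fun p => (f p.1, Df p.1 p.2))
    (hx : x ∈ D) (hx1 : x ∈ S.level 1) :
    IsScFamily S S₂ (D ∩ S.level 1) (fun y => S.nrm 1 (y - x)) (fun y => Df y) (Df x) := by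
  refine ⟨fun y _ => (Df y).isLinear, (hf x hx hx1).bound hS, fun k₀ ε hε => ?_⟩
  obtain ⟨δ, hδ, h⟩ := (hT 0 (x, k₀) ⟨hx, hx1, hS.mem_zero _⟩ ⟨hx1, hS.mem_zero _⟩).2 ε hε
  exact ⟨δ, hδ, fun y hy hyx k hk => (le_max_right _ _).trans_lt
    (h (y, k) ⟨hy.1, hy.2, hS.mem_zero _⟩ ⟨hy.2, hS.mem_zero _⟩ (max_lt hyx hk))⟩

/-- The linearization at a smooth point of a map of class sc¹ with values in `F^i` maps `E_m`
boundedly to `F_{m+i}`. -/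
theorem IsScZero.exists_bound_of_tangent {f : V → V₂} {Df : V → V →ₗ[ℝ] V₂} {i : ℕ} (hS : S.IsSc)
    (hS₂ : S₂.IsSc)
    (hT : IsScZero S.tangent (S₂.shift i).tangent (tangentDomain S D)
      fun p => (f p.1, Df p.1 p.2))
    (hx : x ∈ D) (hx' : x ∈ S.inf) (m : ℕ) :
    ∃ K, ∀ v ∈ S.level m, Df x v ∈ S₂.level (m + i) ∧ S₂.nrm (m + i) (Df x v) ≤ K * S.nrm m v := by
  have hxm : ∀ m, x ∈ S.level m := fun m => Scale.inf_le_level S m hx'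
  -- On level m the tangent scale requires the base point to be in level m + 1; for all m at once
  -- this is smoothness of x.
  obtain ⟨δ, hδ, h⟩ := (hT m (x, 0) ⟨hx, hxm 1, hS.mem_zero _⟩ ⟨hxm (m + 1), zero_mem _⟩).2 1
    one_pos
  refine ⟨2 / δ, hS.exists_bound_of_ball hS₂ (Df x).isLinear hδ fun v hv hlt => ?_⟩
  have hmem : ((x, v) : V × V) ∈ tangentDomain S D := ⟨hx, hxm 1, hS.mem_zero _⟩
  refine ⟨(hT m (x, v) hmem ⟨hxm (m + 1), hv⟩).1.2, ?_⟩
  have h1 := h (x, v) hmem ⟨hxm (m + 1), hv⟩ (max_lt (by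
    change S.nrm (m + 1) (x - x) < δ
    rwa [sub_self, hS.nrm_map_zero]) (by
    change S.nrm m (v - 0) < δ
    rwa [sub_zero]))
  have h2 : S₂.nrm (m + i) (Df x v - Df x 0) < 1 := (le_max_right _ _).trans_lt h1
  rw [map_zero, sub_zero] at h2
  exact h2.le

/-! ### The chain rule -/

variable {F : Type*} [NormedAddCommGroup F] [NormedSpace ℝ F] {T : Scale F}

/-- The mean value inequality on a segment. -/
theorem norm_sub_le_of_hasScDerivAt_segment (hS : S.IsSc) (hT : ∀ y, T.nrm 0 y = ‖y‖)
    {g : V → F} {Dg : V → V →ₗ[ℝ] F}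
    (hg : ∀ y ∈ D, y ∈ S.level 1 → HasScDerivAt S T D g y (Dg y)) {a w : V}
    (hw : w ∈ S.level 1) (hseg : ∀ t ∈ Icc (0 : ℝ) 1, a + t • w ∈ D ∧ a + t • w ∈ S.level 1)
    {b : F} {M : ℝ} (hM : ∀ t ∈ Icc (0 : ℝ) 1, ‖Dg (a + t • w) w - b‖ ≤ M) :
    ‖g (a + w) - g a - b‖ ≤ M := by
  have hder : ∀ t ∈ Icc (0 : ℝ) 1,
      HasDerivWithinAt (fun t : ℝ => g (a + t • w) - t • b) (Dg (a + t • w) w - b)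
        (Icc (0 : ℝ) 1) t := fun t ht => by
    have h1 : HasDerivWithinAt (fun t : ℝ => g (a + t • w)) (Dg (a + t • w) w)
        (Icc (0 : ℝ) 1) t := by
      rw [hasDerivWithinAt_iff_isLittleO, Asymptotics.isLittleO_iff]
      intro ε hε
      -- The increment (s - t) w has level 1 norm |s - t| ‖w‖₁, so an sc-linearization gives an
      -- ordinary derivative along the segment.
      obtain ⟨δ, hδ, h⟩ := (hg _ (hseg t ht).1 (hseg t ht).2).2 (ε / (S.nrm 1 w + 1))
        (by have := hS.nrm_nonneg hw; positivity)
      have hn := hS.nrm_nonneg hw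
      have hball : ∀ᶠ s in 𝓝[Icc (0 : ℝ) 1] t, |s - t| < δ / (S.nrm 1 w + 1) :=
        mem_nhdsWithin_of_mem_nhds (Metric.ball_mem_nhds t (by positivity))
      filter_upwards [hball, self_mem_nhdsWithin] with s hs hsI
      have e1 : a + s • w = a + t • w + (s - t) • w := by
        rw [sub_smul]
        abel
      have hnst : S.nrm 1 ((s - t) • w) = |s - t| * S.nrm 1 w := hS.nrm_smul 1 _ _ hw
      have h2 := h ((s - t) • w) (Submodule.smul_mem _ _ hw) (e1 ▸ (hseg s hsI).1) (by
        rw [hnst]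
        rw [lt_div_iff₀ (by positivity)] at hs
        nlinarith [abs_nonneg (s - t)])
      rw [← e1, hT, hnst, map_smul] at h2
      refine h2.trans ?_
      rw [Real.norm_eq_abs, div_mul_eq_mul_div, div_le_iff₀ (by positivity)]
      nlinarith [mul_nonneg hε.le (abs_nonneg (s - t))]
    have h2 := h1.sub ((hasDerivWithinAt_id t (Icc (0 : ℝ) 1)).smul_const b)
    rw [one_smul] at h2
    exact h2
  have h := norm_image_sub_le_of_norm_deriv_le_segment_01' hder
    fun t ht => hM t (Ico_subset_Icc_self ht)
  simpa [sub_right_comm] using h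

/-- The chain rule. -/
theorem HasScDerivAt.comp (hS : S.IsSc) (hS₁ : S₁.IsSc) (hTsc : T.IsSc) (hT : ∀ y, T.nrm 0 y = ‖y‖)
    {f : V → V₁} {A : V →ₗ[ℝ] V₁} {g : V₁ → F} {B : V₁ →ₗ[ℝ] F} {Q₁ D₁ : Set V₁}
    (hf0 : IsScZero S S₁ D f) (hf : HasScDerivAt S S₁ D f x A) (hx : x ∈ D) (hx1 : x ∈ S.level 1)
    (hmap : MapsTo f D D₁) (hQ : IsScCone S₁ Q₁) (hD₁ : IsScRelOpen S₁ Q₁ D₁)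
    (hg : IsScClass 1 S₁ T D₁ g) (hB : HasScDerivAt S₁ T D₁ g (f x) B) :
    HasScDerivAt S T D (g ∘ f) x (B ∘ₗ A) := by
  obtain ⟨-, Dg, hDg, hTg⟩ := hg
  -- The increment w of f tends to 0 in level 1, but without a rate in ‖v‖₁, so the linearization of
  -- g at f x cannot be applied to w directly. The mean value inequality is used instead, with Dg
  -- controlled along the segment.
  have hy1 : f x ∈ S₁.level 1 := (hf0 1 x hx hx1).1
  have hfam := isScFamily_of_tangent hS₁ hDg hTg (hmap hx) hy1
  have hBe : Dg (f x) = B := (hDg _ (hmap hx) hy1).unique hS₁ hTsc hQ hD₁ (hmap hx) hB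
  rw [hBe] at hfam
  obtain ⟨K, hK0, hK⟩ := hf.bound hS
  obtain ⟨K₀, hK₀0, hK₀⟩ := hB.bound hS₁
  refine ⟨⟨K₀ * K, fun v hv => ⟨hTsc.mem_zero _, (hK₀ _).trans ?_⟩⟩, fun ε hε => ?_⟩
  · rw [mul_assoc]
    exact mul_le_mul_of_nonneg_left (hK v) hK₀0
  obtain ⟨δ₁, hδ₁, C, hC0, hC⟩ := hfam.exists_bound hS₁ hTsc
  obtain ⟨δ₂, hδ₂, hu⟩ := hfam.uniform hS hTsc hK (half_pos hε)
  obtain ⟨δ₃, hδ₃, hr⟩ := hf.2 (ε / (2 * (C + 2 * K₀ + 1))) (by positivity)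
  obtain ⟨η, hη, hball⟩ := hD₁.exists_ball _ (hmap hx)
  obtain ⟨I, hI0, hI⟩ := hS₁.exists_nrm_le (Nat.zero_le 1)
  obtain ⟨δ₄, hδ₄, hcont⟩ := (hf0 1 x hx hx1).2 (min (min δ₁ δ₂) (η / (I + 1))) (by positivity)
  refine ⟨min δ₃ δ₄, lt_min hδ₃ hδ₄, fun v hv hvD hlt => ?_⟩
  have hn := hS.nrm_nonneg hv
  have hxv := add_mem hx1 hv
  have hfv1 : f (x + v) ∈ S₁.level 1 := (hf0 1 _ hvD hxv).1
  set w := f (x + v) - f x with hw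
  have hw1 : w ∈ S₁.level 1 := sub_mem hfv1 hy1
  have hwlt : S₁.nrm 1 w < min (min δ₁ δ₂) (η / (I + 1)) := hcont _ hvD hxv (by
    rw [add_sub_cancel_left]
    exact hlt.trans_le (min_le_right _ _))
  have hwn := hS₁.nrm_nonneg hw1
  have hρ : ∀ t ∈ Icc (0 : ℝ) 1, S₁.nrm 1 (f x + t • w - f x) ≤ S₁.nrm 1 w := fun t ht => by
    rw [add_sub_cancel_left, hS₁.nrm_smul 1 _ _ hw1, abs_of_nonneg ht.1]
    exact mul_le_of_le_one_left hwn ht.2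
  have hseg : ∀ t ∈ Icc (0 : ℝ) 1, f x + t • w ∈ D₁ ∧ f x + t • w ∈ S₁.level 1 := fun t ht => by
    have hl := add_mem hy1 (Submodule.smul_mem _ t hw1)
    refine ⟨hball _ ?_ ?_, hl⟩
    · have : f x + t • w = (1 - t) • f x + t • f (x + v) := by
        rw [hw, sub_smul, smul_sub, one_smul]
        abel
      rw [this]
      exact hQ.add_mem _ (hQ.smul_mem _ (by linarith [ht.2]) _ (hD₁.subset (hmap hx))) _
        (hQ.smul_mem _ ht.1 _ (hD₁.subset (hmap hvD)))
    · have h1 : S₁.nrm 1 w < η / (I + 1) := hwlt.trans_le (min_le_right _ _)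
      rw [lt_div_iff₀ (by positivity)] at h1
      have h2 := hI _ (sub_mem hl hy1)
      have h3 := mul_le_mul_of_nonneg_left (hρ t ht) hI0
      nlinarith
  have hrem := hr v hv hvD (hlt.trans_le (min_le_left _ _))
  rw [← hw] at hrem
  set r := w - A v with hrdef
  have hwr : w = A v + r := by rw [hrdef, add_sub_cancel]
  have hr0 := hS₁.nrm_nonneg (hS₁.mem_zero r)
  -- Split w = A v + r. On A v the operators Dg converge uniformly for v bounded in level 1; on r a
  -- bound of the operators suffices, because r is o(‖v‖₁) in level 0.
  have hM : ∀ t ∈ Icc (0 : ℝ) 1, ‖Dg (f x + t • w) w - B w‖ ≤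
      ε / 2 * S.nrm 1 v + (C + K₀) * S₁.nrm 0 r := fun t ht => by
    have hlt' := (hρ t ht).trans_lt hwlt
    have hδ := hlt'.trans_le (min_le_left _ _)
    have h1 := hu _ (hseg t ht) (hδ.trans_le (min_le_right _ _)) v hv
    have h2 := hC _ (hseg t ht) (hδ.trans_le (min_le_left _ _)) r
    have h3 := hK₀ r
    rw [hT] at h1 h2 h3
    have h4 : Dg (f x + t • w) w - B w =
        (Dg (f x + t • w) (A v) - B (A v)) + (Dg (f x + t • w) r - B r) := by
      have h5 : ∀ L : V₁ →ₗ[ℝ] F, L w = L (A v) + L r := fun L => by rw [← map_add, ← hwr]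
      rw [h5, h5]
      abel
    rw [h4]
    have h5 := norm_add_le (Dg (f x + t • w) (A v) - B (A v)) (Dg (f x + t • w) r - B r)
    have h6 := norm_sub_le (Dg (f x + t • w) r) (B r)
    linarith
  have h1 := norm_sub_le_of_hasScDerivAt_segment hS₁ hT hDg hw1 hseg hM
  have h2 : g (f (x + v)) - g (f x) - B (A v) = (g (f x + w) - g (f x) - B w) + B r := by
    have hfw : f x + w = f (x + v) := by rw [hw, add_sub_cancel]
    have hBr : B r = B w - B (A v) := map_sub B w (A v)
    rw [hfw, hBr]
    abel
  rw [hT]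
  change ‖g (f (x + v)) - g (f x) - B (A v)‖ ≤ _
  rw [h2]
  have h3 := norm_add_le (g (f x + w) - g (f x) - B w) (B r)
  have h4 := hK₀ r
  rw [hT] at h4
  have h5 : (C + 2 * K₀) * S₁.nrm 0 r ≤ ε / 2 * S.nrm 1 v := by
    refine (mul_le_mul_of_nonneg_left hrem (by positivity)).trans ?_
    rw [← mul_assoc]
    refine mul_le_mul_of_nonneg_right ?_ hn
    rw [mul_div_assoc', div_le_div_iff₀ (by positivity) (by positivity)]
    nlinarith
  linarith

end ScCalculus

/-! ## Splicings and charts -/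

theorem ScBanach.norm_eq (W : ScBanach.{u}) (x : W) : ‖x‖ = W.scale.nrm 0 x := (W.nrm_zero x).symm

theorem IsPartialQuadrant.isScCone {W : ScBanach.{u}} {C : Set W} (h : IsPartialQuadrant W C) :
    IsScCone W.scale C := by
  obtain ⟨n, Q, T, hT, hT', himg⟩ := h
  have hC : ∀ x, x ∈ C ↔ ∀ i, 0 ≤ (T x).1 i := fun x => by
    have h1 : T x ∈ T '' C ↔ x ∈ C := T.injective.mem_set_image
    rw [← h1, himg]
    rfl
  refine ⟨fun x hx y hy => ?_, fun a ha x hx => ?_, fun v hv => ?_⟩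
  · rw [hC] at *
    intro i
    simpa using add_nonneg (hx i) (hy i)
  · rw [hC] at *
    intro i
    simpa using mul_nonneg ha (hx i)
  · have hv2 : (T v).2 ∈ Q.scale.level 1 := ((hT 1).choose_spec v hv).1.2
    have hmem : ∀ p : (Fin n → ℝ) × Q, p.2 ∈ Q.scale.level 1 → T.symm p ∈ W.scale.level 1 :=
      fun p hp => ((hT' 1).choose_spec p ⟨trivial, hp⟩).1
    -- Positive and negative parts of the ℝⁿ component; the Q component is unconstrained and goes to
    -- the first vector.
    refine ⟨T.symm (fun i => max ((T v).1 i) 0, (T v).2), ?_,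
      T.symm (fun i => max (-(T v).1 i) 0, 0), ?_, hmem _ hv2, hmem _ (zero_mem _), ?_⟩
    · rw [hC, T.apply_symm_apply]
      exact fun i => le_max_right _ _
    · rw [hC, T.apply_symm_apply]
      exact fun i => le_max_right _ _
    · rw [← map_sub, LinearEquiv.eq_symm_apply]
      refine Prod.ext (funext fun i => ?_) (sub_zero _).symm
      exact (max_zero_sub_max_neg_zero_eq_self _).symm

namespace Splicing

variable (S : Splicing.{u}) {O : Set (S.W × S.E)}

theorem isSc_scale : S.scale.IsSc := S.W.isSc.prod S.E.isSc

/-- The partial cone in which the domains `Ô` are open. -/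
def cone : Set (S.W × S.E) := S.C ×ˢ univ

theorem isScCone_cone : IsScCone S.scale S.cone := by
  have h := S.quadrant.isScCone
  refine ⟨fun x hx y hy => ⟨h.add_mem _ hx.1 _ hy.1, trivial⟩,
    fun a ha x hx => ⟨h.smul_mem a ha _ hx.1, trivial⟩, fun v hv => ?_⟩
  obtain ⟨a, ha, b, hb, ha1, hb1, hab⟩ := h.exists_sub v.1 hv.1
  exact ⟨(a, v.2), ⟨ha, trivial⟩, (b, 0), ⟨hb, trivial⟩, ⟨ha1, hv.2⟩, ⟨hb1, zero_mem _⟩,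
    Prod.ext hab (sub_zero _).symm⟩

theorem retr_mem_core {x : S.W × S.E} (hx : x.1 ∈ S.V) : S.retr x ∈ S.core :=
  ⟨hx, S.idem _ hx _⟩

theorem retr_eq_self {x : S.W × S.E} (hx : x ∈ S.core) : S.retr x = x :=
  Prod.ext rfl hx.2

/-- Ô is the preimage of O under the retraction, which is continuous on level 0 since the splicing
is sc⁰. This makes uniqueness and locality of linearizations available on Ô. -/
theorem isScRelOpen_hat (hO : S.IsOpenInCore O) : IsScRelOpen S.scale S.cone (S.hat O) := by
  obtain ⟨G, hG, rfl⟩ := hO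
  obtain ⟨G', hG', hV⟩ := S.isOpen_V
  refine ⟨fun x hx => ⟨(hV ▸ hx.1 : x.1 ∈ S.C ∩ G').1, trivial⟩, fun x hx => ?_⟩
  obtain ⟨r, hr, hball⟩ := Metric.isOpen_iff.1 hG _ hx.2.2
  obtain ⟨r', hr', hball'⟩ := Metric.isOpen_iff.1 hG' _ (hV ▸ hx.1 : x.1 ∈ S.C ∩ G').2
  obtain ⟨-, hc⟩ := S.smooth 0 0 x ⟨hx.1, trivial⟩ (S.isSc_scale.mem_zero x)
  obtain ⟨δ, hδ, hc⟩ := hc r hr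
  refine ⟨min δ (min r r'), by positivity, fun y hy hlt => ?_⟩
  have h1 : ‖y.1 - x.1‖ < min δ (min r r') := by
    rw [S.W.norm_eq]
    exact (le_max_left _ _).trans_lt hlt
  have hyV : y.1 ∈ S.V := by
    rw [hV]
    refine ⟨hy.1, hball' ?_⟩
    rw [Metric.mem_ball, dist_eq_norm]
    exact h1.trans_le ((min_le_right _ _).trans (min_le_right _ _))
  refine ⟨hyV, S.retr_mem_core hyV, hball ?_⟩
  rw [Metric.mem_ball, dist_eq_norm, Prod.norm_def]
  refine max_lt (h1.trans_le ((min_le_right _ _).trans (min_le_left _ _))) ?_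
  rw [S.E.norm_eq]
  exact hc y ⟨hyV, trivial⟩ (S.isSc_scale.mem_zero y) (hlt.trans_le (min_le_left _ _))

theorem subset_hat (hO : O ⊆ S.core) : O ⊆ S.hat O := fun x hx =>
  ⟨(hO hx).1, by rwa [S.retr_eq_self (hO hx)]⟩

theorem hat_mono {O' : Set (S.W × S.E)} (h : O ⊆ O') : S.hat O ⊆ S.hat O' :=
  fun _ hx => ⟨hx.1, h hx.2⟩

end Splicing

namespace MChart

variable {X : Type v} [TopologicalSpace X] (c : MChart.{u} X) {N : Set X}

theorem target_subset_core : c.φ.target ⊆ c.S.core := by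
  obtain ⟨G, -, h⟩ := c.isOpen_target
  exact h ▸ inter_subset_left

theorem image_eq : c.φ '' (c.φ.source ∩ N) = c.φ.target ∩ c.φ.symm ⁻¹' N := by
  rw [c.φ.image_source_inter_eq']

theorem image_subset_target : c.φ '' (c.φ.source ∩ N) ⊆ c.φ.target := by
  rw [image_eq]
  exact inter_subset_left

theorem image_subset_core : c.φ '' (c.φ.source ∩ N) ⊆ c.S.core :=
  c.image_subset_target.trans c.target_subset_core

theorem isOpenInCore_image (hN : IsOpen N) : c.S.IsOpenInCore (c.φ '' (c.φ.source ∩ N)) := by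
  obtain ⟨G, hG, h⟩ := c.isOpen_target
  obtain ⟨G', hG', h'⟩ := continuousOn_iff'.1 c.continuousOn_symm N hN
  refine ⟨G ∩ G', hG.inter hG', ?_⟩
  rw [image_eq, inter_comm, h', inter_comm, h, inter_assoc]

end MChart

/-! ## Bundle charts -/

section Bundle

variable {X : Type v} [TopologicalSpace X] {Y : X → Type w} [∀ x, NormedAddCommGroup (Y x)]
  [∀ x, NormedSpace ℝ (Y x)] [TopologicalSpace (BundleTotal Y)]

namespace BundleChart

variable (c d : BundleChart.{u} Y) {x q : X}

theorem fib_injective (hx : x ∈ c.base.φ.source) : Function.Injective (c.fib x) := by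
  obtain ⟨K, hK⟩ := c.bounded_below x hx
  refine (injective_iff_map_eq_zero _).2 fun y hy => ?_
  have := hK y
  rw [hy, norm_zero, mul_zero] at this
  exact norm_le_zero_iff.1 this

theorem mk_mem_source (hx : x ∈ c.base.φ.source) (y : Y x) :
    (⟨x, y⟩ : BundleTotal Y) ∈ c.Φ.source := by
  rw [c.source_eq]
  exact hx

theorem apply_mk (hx : x ∈ c.base.φ.source) (y : Y x) :
    c.Φ ⟨x, y⟩ = (c.base.φ x, c.fib x y) := c.apply_eq _ (c.mk_mem_source hx y)

theorem symm_apply (hx : x ∈ c.base.φ.source) (y : Y x) :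
    c.Φ.symm (c.base.φ x, c.fib x y) = ⟨x, y⟩ := by
  rw [← c.apply_mk hx, c.Φ.left_inv (c.mk_mem_source hx y)]

theorem ρ_fib (hx : x ∈ c.base.φ.source) (y : Y x) :
    c.R.ρ (c.base.φ x) (c.fib x y) = c.fib x y := by
  have h := c.Φ.map_source (c.mk_mem_source hx y)
  rw [c.apply_mk hx, c.target_eq] at h
  exact h.2

/-- Together with `ρ_fib` this identifies the fiber with the image of the projection ρ. The point
Φ⁻¹(φ x, k) lies over x because φ is injective on its domain. -/
theorem exists_fib_eq (hx : x ∈ c.base.φ.source) {k : c.R.F} (hk : c.R.ρ (c.base.φ x) k = k) :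
    ∃ y, c.fib x y = k := by
  have h : (c.base.φ x, k) ∈ c.Φ.target := by
    rw [c.target_eq]
    exact ⟨c.base.φ.map_source hx, hk⟩
  have h1 := c.Φ.map_target h
  have h2 := c.Φ.right_inv h
  generalize c.Φ.symm (c.base.φ x, k) = z at h1 h2
  obtain ⟨x', y'⟩ := z
  have h3 : x' ∈ c.base.φ.source := by
    rw [c.source_eq] at h1
    exact h1
  rw [c.apply_mk h3, Prod.mk.injEq] at h2
  obtain rfl := c.base.φ.injOn h3 hx h2.1
  exact ⟨y', h2.2⟩

theorem principal_apply (hx : x ∈ c.base.φ.source) (f : ∀ x, Y x) :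
    c.principal f (c.base.φ x) = c.fib x (f x) := by
  rw [principal, c.base.φ.left_inv hx]

theorem principal_sub (f s : ∀ x, Y x) : c.principal (f - s) = c.principal f - c.principal s := by
  funext p
  exact map_sub _ _ _

/-- The fiber part of the transition map from `c` to `d`, composed with the projection onto the
splicing core. -/
def fiberTransition (z : c.base.S.W × c.base.S.E) (k : c.R.F) : d.R.F :=
  (d.Φ (c.Φ.symm (c.R.retr (z, k)))).2

variable {c d}

/-- Naming the fiber vector y that ρ k represents turns the transition into the passage from one
chart expression of y to another. -/
theorem fiberTransition_eq {z : c.base.S.W × c.base.S.E} (hc : x ∈ c.base.φ.source)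
    (hd : x ∈ d.base.φ.source) (hz : c.base.S.retr z = c.base.φ x) {k : c.R.F} {y : Y x}
    (hk : c.R.ρ (c.base.φ x) k = c.fib x y) : c.fiberTransition d z k = d.fib x y := by
  have h : c.R.retr (z, k) = (c.base.φ x, c.fib x y) := by
    rw [StrongBundleSplicing.retr, hz, hk]
  rw [fiberTransition, h, c.symm_apply hc, d.apply_mk hd]

theorem exists_of_mem_hat_overlap {z : c.base.S.W × c.base.S.E}
    (hz : z ∈ c.base.S.hat (c.base.overlap d.base)) :
    ∃ x, x ∈ c.base.φ.source ∧ x ∈ d.base.φ.source ∧ c.base.S.retr z = c.base.φ x := by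
  obtain ⟨x, hx, h⟩ := hz.2
  exact ⟨x, hx.1, hx.2, h.symm⟩

theorem exists_fib_eq_ρ (hx : x ∈ c.base.φ.source) (k : c.R.F) :
    ∃ y, c.R.ρ (c.base.φ x) k = c.fib x y := by
  obtain ⟨y, hy⟩ := c.exists_fib_eq hx (c.R.idem _ (c.base.φ.map_source hx) k)
  exact ⟨y, hy.symm⟩

theorem isLinearMap_fiberTransition {z : c.base.S.W × c.base.S.E}
    (hz : z ∈ c.base.S.hat (c.base.overlap d.base)) : IsLinearMap ℝ (c.fiberTransition d z) := by
  obtain ⟨x, hc, hd, hzx⟩ := exists_of_mem_hat_overlap hz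
  refine ⟨fun k k' => ?_, fun a k => ?_⟩
  · obtain ⟨y, hy⟩ := exists_fib_eq_ρ hc k
    obtain ⟨y', hy'⟩ := exists_fib_eq_ρ hc k'
    rw [fiberTransition_eq hc hd hzx hy, fiberTransition_eq hc hd hzx hy', ← map_add]
    exact fiberTransition_eq hc hd hzx (by rw [map_add, map_add, hy, hy'])
  · obtain ⟨y, hy⟩ := exists_fib_eq_ρ hc k
    rw [fiberTransition_eq hc hd hzx hy, ← map_smul]
    exact fiberTransition_eq hc hd hzx (by rw [map_smul, map_smul, hy])

theorem mem_overlap (hc : q ∈ c.base.φ.source) (hd : q ∈ d.base.φ.source) :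
    c.base.φ q ∈ c.base.overlap d.base := ⟨q, ⟨hc, hd⟩, rfl⟩

theorem mem_hat_overlap (hc : q ∈ c.base.φ.source) (hd : q ∈ d.base.φ.source) :
    c.base.φ q ∈ c.base.S.hat (c.base.overlap d.base) :=
  c.base.S.subset_hat c.base.image_subset_core (mem_overlap hc hd)

/-- The fiber parts of the transition maps form a continuous family. -/
theorem isScFamily_fiberTransition (h : TransitionSmooth 0 c d) (hc : q ∈ c.base.φ.source)
    (hd : q ∈ d.base.φ.source) :
    IsScFamily c.R.F.scale d.R.F.scale (c.base.S.hat (c.base.overlap d.base))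
      (fun z => c.base.S.scale.nrm 0 (z - c.base.φ q)) (c.fiberTransition d)
      (isLinearMap_fiberTransition (mem_hat_overlap hc hd)).mk' := by
  have hq := mem_hat_overlap hc hd
  have hcont : ∀ k₀, ∀ ε > 0, ∃ δ > 0, ∀ z ∈ c.base.S.hat (c.base.overlap d.base),
      c.base.S.scale.nrm 0 (z - c.base.φ q) < δ → ∀ k, c.R.F.scale.nrm 0 (k - k₀) < δ →
      d.R.F.scale.nrm 0 (c.fiberTransition d z k - c.fiberTransition d (c.base.φ q) k₀) < ε := by
    intro k₀ ε hε
    -- Only sc⁰-continuity on level 0 of the bundle transition is used.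
    obtain ⟨δ, hδ, hlim⟩ := (h 0 0 (c.base.φ q, k₀) ⟨hq, c.R.F.isSc.mem_zero _⟩
      ⟨c.base.S.isSc_scale.mem_zero _, c.R.F.isSc.mem_zero _⟩).2 ε hε
    exact ⟨δ, hδ, fun z hz hzlt k hk => (le_max_right _ _).trans_lt (hlim (z, k)
      ⟨hz, c.R.F.isSc.mem_zero _⟩ ⟨c.base.S.isSc_scale.mem_zero _, c.R.F.isSc.mem_zero _⟩
      (max_lt hzlt hk))⟩
  refine ⟨fun z hz => isLinearMap_fiberTransition hz, ?_, hcont⟩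
  have hlin := isLinearMap_fiberTransition hq
  obtain ⟨δ, hδ, hlim⟩ := hcont 0 1 one_pos
  refine ⟨2 / δ, by positivity, fun k => (c.R.F.isSc.exists_bound_of_ball d.R.F.isSc hlin hδ
    (fun k _ hlt => ⟨d.R.F.isSc.mem_zero _, ?_⟩) k (c.R.F.isSc.mem_zero k)).2⟩
  have := hlim _ hq (by rwa [sub_self, c.base.S.isSc_scale.nrm_map_zero]) k (by rwa [sub_zero])
  rw [hlin.map_zero, sub_zero] at this
  exact this.le

end BundleChart

/-! ### Derivatives of principal parts and the linearization -/

namespace StrongBundle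

variable {M : MPolyfold.{u} X} {B : StrongBundle Y M} {q : X}

/-- The derivative at `q` of the principal part of a section in a bundle chart. -/
noncomputable def principalDeriv (c : B.ChartAt q) (f : ∀ x, Y x) :
    c.1.base.S.W × c.1.base.S.E →ₗ[ℝ] c.1.R.F :=
  c.1.base.S.deriv c.1.R.F.scale c.1.base.φ.target (c.1.principal f) (c.1.base.φ q)

theorem ChartAt.mem_target (c : B.ChartAt q) : c.1.base.φ q ∈ c.1.base.S.hat c.1.base.φ.target :=
  c.1.base.S.subset_hat c.1.base.target_subset_core (c.1.base.φ.map_source c.2.2)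

theorem ChartAt.mem_image (c : B.ChartAt q) {N : Set X} (hN : q ∈ N) :
    c.1.base.φ q ∈ c.1.base.S.hat (c.1.base.φ '' (c.1.base.φ.source ∩ N)) :=
  c.1.base.S.subset_hat c.1.base.image_subset_core ⟨q, ⟨c.2.2, hN⟩, rfl⟩

theorem ChartAt.mem_inf (c : B.ChartAt q) (hq : M.IsSmoothPoint q) :
    c.1.base.φ q ∈ c.1.base.S.scale.inf := hq c.toBase

theorem ChartAt.mem_level (c : B.ChartAt q) (hq : M.IsSmoothPoint q) (m : ℕ) :
    c.1.base.φ q ∈ c.1.base.S.scale.level m := Scale.inf_le_level _ m (c.mem_inf hq)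

/-- A linearization of a principal part near `q` is the derivative. -/
theorem hasScDerivAt_principal_of_near (c : B.ChartAt q) {f : ∀ x, Y x} {N : Set X} (hN : IsOpen N)
    (hqN : q ∈ N) {A : c.1.base.S.W × c.1.base.S.E →ₗ[ℝ] c.1.R.F}
    (hA : HasScDerivAt c.1.base.S.scale c.1.R.F.scale
      (c.1.base.S.hat (c.1.base.φ '' (c.1.base.φ.source ∩ N)))
      (c.1.principal f ∘ c.1.base.S.retr) (c.1.base.φ q) A) :
    HasScDerivAt c.1.base.S.scale c.1.R.F.scale (c.1.base.S.hat c.1.base.φ.target)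
      (c.1.principal f ∘ c.1.base.S.retr) (c.1.base.φ q) A ∧ principalDeriv c f = A := by
  have hop := c.1.base.S.isScRelOpen_hat c.1.base.isOpen_target
  have h := hA.of_isScRelOpen c.1.base.S.isSc_scale (c.mem_image hqN)
    (c.1.base.S.isScRelOpen_hat (c.1.base.isOpenInCore_image hN)) hop.subset
  exact ⟨h, h.scDeriv_eq c.1.base.S.isSc_scale c.1.R.F.isSc c.1.base.S.isScCone_cone hop
    c.mem_target⟩

theorem IsScSection.hasScDerivAt_principal {f : ∀ x, Y x} (hf : B.IsScSection f q)
    (hq : M.IsSmoothPoint q) (c : B.ChartAt q) :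
    HasScDerivAt c.1.base.S.scale c.1.R.F.scale (c.1.base.S.hat c.1.base.φ.target)
      (c.1.principal f ∘ c.1.base.S.retr) (c.1.base.φ q) (principalDeriv c f) := by
  obtain ⟨N, hN, hqN, hs⟩ := hf
  obtain ⟨-, Df, hDf, -⟩ := hs c.1 c.2.1 1
  obtain ⟨h, heq⟩ := hasScDerivAt_principal_of_near c hN hqN
    (hDf _ (c.mem_image hqN) (c.mem_level hq 1))
  rwa [heq]

/-- The derivative of an sc⁺-section at a smooth point gains a level. -/
theorem IsScPlusSection.exists_bound_principalDeriv {s : ∀ x, Y x} (hs : B.IsScPlusSection s q)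
    (hq : M.IsSmoothPoint q) (c : B.ChartAt q) (m : ℕ) :
    ∃ K, ∀ v ∈ c.1.base.S.scale.level m, principalDeriv c s v ∈ c.1.R.F.scale.level (m + 1) ∧
      c.1.R.F.scale.nrm (m + 1) (principalDeriv c s v) ≤ K * c.1.base.S.scale.nrm m v := by
  obtain ⟨N, hN, hqN, hs⟩ := hs.2
  obtain ⟨h0, Df, hDf, hT⟩ := hs c.1 c.2.1 1
  -- The linearization for F^1 is also one for F, so by uniqueness it is the derivative in question
  -- and the gain of a level passes to it.
  obtain ⟨-, heq⟩ := hasScDerivAt_principal_of_near c hN hqN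
    ((hDf _ (c.mem_image hqN) (c.mem_level hq 1)).of_shift c.1.base.S.isSc_scale c.1.R.F.isSc
      (fun y hy => (h0 0 y hy (c.1.base.S.isSc_scale.mem_zero y)).1) (c.mem_image hqN))
  rw [heq]
  exact IsScZero.exists_bound_of_tangent c.1.base.S.isSc_scale c.1.R.F.isSc hT (c.mem_image hqN)
    (c.mem_inf hq) m

theorem principalDeriv_sub {f s : ∀ x, Y x} (hf : B.IsScSection f q) (hs : B.IsScSection s q)
    (hq : M.IsSmoothPoint q) (c : B.ChartAt q) :
    HasScDerivAt c.1.base.S.scale c.1.R.F.scale (c.1.base.S.hat c.1.base.φ.target)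
      (c.1.principal (f - s) ∘ c.1.base.S.retr) (c.1.base.φ q)
      (principalDeriv c f - principalDeriv c s) ∧
    principalDeriv c (f - s) = principalDeriv c f - principalDeriv c s := by
  have h := (hf.hasScDerivAt_principal hq c).sub c.1.R.F.isSc (hs.hasScDerivAt_principal hq c)
  have h' : HasScDerivAt c.1.base.S.scale c.1.R.F.scale (c.1.base.S.hat c.1.base.φ.target)
      (c.1.principal (f - s) ∘ c.1.base.S.retr) (c.1.base.φ q)
      (principalDeriv c f - principalDeriv c s) := by
    rw [c.1.principal_sub]
    exact h
  exact ⟨h', h'.scDeriv_eq c.1.base.S.isSc_scale c.1.R.F.isSc c.1.base.S.isScCone_cone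
    (c.1.base.S.isScRelOpen_hat c.1.base.isOpen_target) c.mem_target⟩

/-- The tangent map at `q` of the transition map of the base. -/
noncomputable def transitionDeriv (c d : B.ChartAt q) :
    c.1.base.S.W × c.1.base.S.E →ₗ[ℝ] d.1.base.S.W × d.1.base.S.E :=
  c.1.base.S.deriv d.1.base.S.scale (c.1.base.overlap d.1.base) (c.1.base.transition d.1.base)
    (c.1.base.φ q)

theorem isScRelOpen_hat_overlap (c d : B.ChartAt q) :
    IsScRelOpen c.1.base.S.scale c.1.base.S.cone
      (c.1.base.S.hat (c.1.base.overlap d.1.base)) :=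
  c.1.base.S.isScRelOpen_hat (c.1.base.isOpenInCore_image d.1.base.isOpen_source)

theorem ChartAt.mem_hat_overlap (c d : B.ChartAt q) :
    c.1.base.φ q ∈ c.1.base.S.hat (c.1.base.overlap d.1.base) :=
  BundleChart.mem_hat_overlap c.2.2 d.2.2

theorem transition_apply (c d : B.ChartAt q) {x : X} (hx : x ∈ c.1.base.φ.source) :
    c.1.base.transition d.1.base (c.1.base.φ x) = d.1.base.φ x := by
  rw [MChart.transition, Function.comp_apply, c.1.base.φ.left_inv hx]

theorem hasScDerivAt_transition (hq : M.IsSmoothPoint q) (c d : B.ChartAt q) :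
    HasScDerivAt c.1.base.S.scale d.1.base.S.scale
      (c.1.base.S.hat (c.1.base.overlap d.1.base))
      (c.1.base.transition d.1.base ∘ c.1.base.S.retr) (c.1.base.φ q) (transitionDeriv c d) := by
  obtain ⟨-, Df, hDf, -⟩ :=
    (M.compatible _ (B.base_mem c.1 c.2.1) _ (B.base_mem d.1 d.2.1)).1 1
  have h := hDf _ (c.mem_hat_overlap d) (c.mem_level hq 1)
  have heq : transitionDeriv c d = Df (c.1.base.φ q) := h.scDeriv_eq c.1.base.S.isSc_scale
    d.1.base.S.isSc_scale c.1.base.S.isScCone_cone (isScRelOpen_hat_overlap c d)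
    (c.mem_hat_overlap d)
  rwa [heq]

/-- The chain rule for the principal part in one chart and the transition map from another chart. -/
theorem IsScSection.hasScDerivAt_principal_transition {f : ∀ x, Y x} (hf : B.IsScSection f q)
    (hq : M.IsSmoothPoint q) (c d : B.ChartAt q) :
    HasScDerivAt c.1.base.S.scale d.1.R.F.scale
      (c.1.base.S.hat (c.1.base.overlap d.1.base))
      (d.1.principal f ∘ c.1.base.transition d.1.base ∘ c.1.base.S.retr) (c.1.base.φ q)
      (principalDeriv d f ∘ₗ transitionDeriv c d) := by
  have hder := hf.hasScDerivAt_principal hq d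
  obtain ⟨N, hN, hqN, hs⟩ := hf
  set τ := c.1.base.transition d.1.base ∘ c.1.base.S.retr with hτ
  -- The overlap is shrunk so that τ maps into the part of the chart `d` where the principal part is
  -- known to be smooth; locality restores the full overlap at the end.
  set D := c.1.base.S.hat (c.1.base.φ '' (c.1.base.φ.source ∩ (d.1.base.φ.source ∩ N))) with hD
  set D₁ := d.1.base.S.hat (d.1.base.φ '' (d.1.base.φ.source ∩ N)) with hD₁
  have hDsub : D ⊆ c.1.base.S.hat (c.1.base.overlap d.1.base) :=
    c.1.base.S.hat_mono (image_mono (inter_subset_inter_right _ inter_subset_left))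
  have hqD : c.1.base.φ q ∈ D := c.mem_image ⟨d.2.2, hqN⟩
  have hDo : IsScRelOpen c.1.base.S.scale c.1.base.S.cone D :=
    c.1.base.S.isScRelOpen_hat (c.1.base.isOpenInCore_image (d.1.base.isOpen_source.inter hN))
  have hτx : ∀ z ∈ D, τ z ∈ d.1.base.φ '' (d.1.base.φ.source ∩ N) := fun z hz => by
    obtain ⟨x, hx, hxz⟩ := hz.2
    refine ⟨x, hx.2, ?_⟩
    rw [hτ, Function.comp_apply, ← hxz, transition_apply c d hx.1]
  have hτq : τ (c.1.base.φ q) = d.1.base.φ q := by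
    rw [hτ, Function.comp_apply, c.1.base.S.retr_eq_self
      (c.1.base.target_subset_core (c.1.base.φ.map_source c.2.2)), transition_apply c d c.2.2]
  have h0 := (M.compatible _ (B.base_mem c.1 c.2.1) _ (B.base_mem d.1 d.2.1)).1 0
  have h0' : IsScZero c.1.base.S.scale d.1.base.S.scale D τ := fun m x hx hxm => by
    obtain ⟨h1, h2⟩ := h0 m x (hDsub hx) hxm
    exact ⟨h1, fun ε hε => (h2 ε hε).imp fun δ hδ => ⟨hδ.1, fun y hy => hδ.2 y (hDsub hy)⟩⟩
  have hcomp := HasScDerivAt.comp c.1.base.S.isSc_scale d.1.base.S.isSc_scale d.1.R.F.isSc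
    d.1.R.F.nrm_zero h0' ((hasScDerivAt_transition hq c d).mono hDsub) hqD (c.mem_level hq 1)
    (fun z hz => d.1.base.S.subset_hat d.1.base.image_subset_core (hτx z hz))
    d.1.base.S.isScCone_cone (d.1.base.S.isScRelOpen_hat (d.1.base.isOpenInCore_image hN))
    (hs d.1 d.2.1 1) (B := principalDeriv d f)
    (hτq.symm ▸ hder.mono (d.1.base.S.hat_mono d.1.base.image_subset_target))
  refine (hcomp.congr hqD fun z hz => ?_).of_isScRelOpen c.1.base.S.isSc_scale hqD hDo
    (isScRelOpen_hat_overlap c d).subset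
  simp only [Function.comp_apply]
  rw [d.1.base.S.retr_eq_self (d.1.base.image_subset_core (hτx z hz))]

/-- For a section which vanishes at `q`, the derivatives of the principal parts in two charts
correspond to the same vectors of the fiber. -/
theorem exists_fib_eq_of_hasScDerivAt (c d : B.ChartAt q) {σ : ∀ x, Y x} (hσ : σ q = 0)
    {A : c.1.base.S.W × c.1.base.S.E →ₗ[ℝ] c.1.R.F}
    {A' : c.1.base.S.W × c.1.base.S.E →ₗ[ℝ] d.1.R.F}
    (hA : HasScDerivAt c.1.base.S.scale c.1.R.F.scale (c.1.base.S.hat c.1.base.φ.target)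
      (c.1.principal σ ∘ c.1.base.S.retr) (c.1.base.φ q) A)
    (hA' : HasScDerivAt c.1.base.S.scale d.1.R.F.scale
      (c.1.base.S.hat (c.1.base.overlap d.1.base))
      (d.1.principal σ ∘ c.1.base.transition d.1.base ∘ c.1.base.S.retr) (c.1.base.φ q) A')
    (k : c.1.base.S.W × c.1.base.S.E) :
    ∃ y, c.1.R.ρ (c.1.base.φ q) (A k) = c.1.fib q y ∧ A' k = d.1.fib q y := by
  have hsub : c.1.base.S.hat (c.1.base.overlap d.1.base) ⊆ c.1.base.S.hat c.1.base.φ.target :=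
    c.1.base.S.hat_mono c.1.base.image_subset_target
  have hretr : c.1.base.S.retr (c.1.base.φ q) = c.1.base.φ q :=
    c.1.base.S.retr_eq_self (c.1.base.target_subset_core (c.1.base.φ.map_source c.2.2))
  have hfam := BundleChart.isScFamily_fiberTransition (B.compatible _ c.2.1 _ d.2.1).1 c.2.2 d.2.2
  have hzero : (c.1.principal σ ∘ c.1.base.S.retr) (c.1.base.φ q) = 0 := by
    rw [Function.comp_apply, hretr, c.1.principal_apply c.2.2, hσ, map_zero]
  -- This is g_d ∘ τ = Γ g_c on the overlap, differentiated at the zero φ(q) of g_c; uniqueness then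
  -- compares it with A'.
  have h := (hfam.hasScDerivAt c.1.base.S.isSc_scale c.1.R.F.isSc d.1.R.F.isSc
    (c.mem_hat_overlap d) (hA.mono hsub) hzero).congr (c.mem_hat_overlap d)
    (g := d.1.principal σ ∘ c.1.base.transition d.1.base ∘ c.1.base.S.retr) fun z hz => by
      obtain ⟨x, hxc, hxd, hzx⟩ := BundleChart.exists_of_mem_hat_overlap hz
      simp only [Function.comp_apply]
      rw [hzx, transition_apply c d hxc, c.1.principal_apply hxc, d.1.principal_apply hxd]
      exact BundleChart.fiberTransition_eq hxc hxd hzx (c.1.ρ_fib hxc _)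
  have heq := hA'.unique c.1.base.S.isSc_scale d.1.R.F.isSc c.1.base.S.isScCone_cone
    (isScRelOpen_hat_overlap c d) (c.mem_hat_overlap d) h
  obtain ⟨y, hy⟩ := BundleChart.exists_fib_eq_ρ c.2.2 (A k)
  refine ⟨y, hy, ?_⟩
  rw [heq]
  exact BundleChart.fiberTransition_eq c.2.2 d.2.2 hretr hy

/-- The comparison of charts applied to a chart and itself: the fiber transition is then ρ, so the
derivative is fixed by ρ and comes from the fiber. -/
theorem exists_fib_eq_principalDeriv {f s : ∀ x, Y x} (hf : B.IsScSection f q)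
    (hs : B.IsScSection s q) (hfs : s q = f q) (hq : M.IsSmoothPoint q) (c : B.ChartAt q)
    (k : c.1.base.S.W × c.1.base.S.E) : ∃ y, c.1.fib q y = principalDeriv c (f - s) k := by
  obtain ⟨hA, heq⟩ := principalDeriv_sub hf hs hq c
  have hσ : (f - s) q = 0 := by rw [Pi.sub_apply, hfs, sub_self]
  have hsub : c.1.base.S.hat (c.1.base.overlap c.1.base) ⊆ c.1.base.S.hat c.1.base.φ.target :=
    c.1.base.S.hat_mono c.1.base.image_subset_target
  obtain ⟨y, -, hy⟩ := exists_fib_eq_of_hasScDerivAt c c hσ hA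
    ((hA.mono hsub).congr (c.mem_hat_overlap c) fun z hz => by
      obtain ⟨x, hxc, -, hzx⟩ := BundleChart.exists_of_mem_hat_overlap hz
      simp only [Function.comp_apply]
      rw [hzx, transition_apply c c hxc]) k
  exact ⟨y, by rw [heq, hy]⟩

/-- Chart independence: the chain rule expresses the derivative of the transported principal part
through `transitionDeriv`, and both chart expressions belong to one fiber vector. -/
theorem fib_eq_principalDeriv_transition {f s : ∀ x, Y x} (hf : B.IsScSection f q)
    (hs : B.IsScSection s q) (hfs : s q = f q) (hq : M.IsSmoothPoint q) (c d : B.ChartAt q)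
    {k : c.1.base.S.W × c.1.base.S.E} {y : Y q} (hy : c.1.fib q y = principalDeriv c (f - s) k) :
    d.1.fib q y = principalDeriv d (f - s) (transitionDeriv c d k) := by
  obtain ⟨hA, heq⟩ := principalDeriv_sub hf hs hq c
  obtain ⟨-, heq'⟩ := principalDeriv_sub hf hs hq d
  have hσ : (f - s) q = 0 := by rw [Pi.sub_apply, hfs, sub_self]
  have hA' := (hf.hasScDerivAt_principal_transition hq c d).sub d.1.R.F.isSc
    (hs.hasScDerivAt_principal_transition hq c d)
  obtain ⟨y', hy'c, hy'd⟩ := exists_fib_eq_of_hasScDerivAt c d hσ hA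
    (hA'.congr (c.mem_hat_overlap d) fun z _ => by rw [d.1.principal_sub]; rfl) k
  rw [← heq, ← hy, c.1.ρ_fib c.2.2] at hy'c
  rw [c.1.fib_injective c.2.2 hy'c, ← hy'd, heq']
  rfl

/-- The linearization exists. -/
theorem exists_isLinearization {f s : ∀ x, Y x} (hf : B.IsScSection f q)
    (hs : B.IsScSection s q) (hfs : s q = f q) (hq : M.IsSmoothPoint q) :
    ∃ L, B.IsLinearization f s q L := by
  obtain ⟨c₀, hc₀, hqc₀⟩ := B.cover q
  let c : B.ChartAt q := ⟨c₀, hc₀, hqc₀⟩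
  let e := LinearEquiv.ofInjective (c.1.fib q : Y q →ₗ[ℝ] c.1.R.F) (c.1.fib_injective c.2.2)
  let L : M.tangentSpace q →ₗ[ℝ] Y q := e.symm.toLinearMap ∘ₗ
    (LinearMap.codRestrict _ (principalDeriv c (f - s))
      (exists_fib_eq_principalDeriv hf hs hfs hq c)) ∘ₗ M.rep c.toBase
  have hL : ∀ v, c.1.fib q (L v) = principalDeriv c (f - s) (M.rep c.toBase v) := fun v =>
    congrArg Subtype.val (e.apply_symm_apply _)
  refine ⟨L, fun d v => ?_⟩
  rw [fib_eq_principalDeriv_transition hf hs hfs hq c d (hL v)]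
  -- Compatibility of representatives under transition derivatives is built into the definition of a
  -- tangent vector.
  have hv : transitionDeriv c d (M.rep c.toBase v) = M.rep d.toBase v := v.2.2 c.toBase d.toBase
  rw [hv]
  rfl

theorem IsLinearization.unique {f s : ∀ x, Y x} {L L' : M.tangentSpace q →ₗ[ℝ] Y q}
    (h : B.IsLinearization f s q L) (h' : B.IsLinearization f s q L') : L = L' := by
  obtain ⟨c₀, hc₀, hqc₀⟩ := B.cover q
  let c : B.ChartAt q := ⟨c₀, hc₀, hqc₀⟩
  exact LinearMap.ext fun v => c.1.fib_injective c.2.2 ((h c v).trans (h' c v).symm)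

theorem isLinearization_linearization {f s : ∀ x, Y x} (hf : B.IsScSection f q)
    (hs : B.IsScSection s q) (hfs : s q = f q) (hq : M.IsSmoothPoint q) :
    B.IsLinearization f s q (B.linearization f s q) := by
  have h := exists_isLinearization hf hs hfs hq
  rw [linearization, dif_pos h]
  exact h.choose_spec

/-- One representative determines all others through the transition derivatives. -/
theorem rep_injective (c : B.ChartAt q) : Function.Injective (M.rep c.toBase) := by
  refine (injective_iff_map_eq_zero _).2 fun v hv => Subtype.ext (funext fun d => ?_)
  have h := v.2.2 c.toBase d
  have hv' : v.1 c.toBase = 0 := hv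
  rw [hv', map_zero] at h
  exact h.symm

/-- The difference of two linearizations is an sc⁺-operator. -/
theorem isScPlusOperator_linearization_sub {f s t : ∀ x, Y x} (hf : B.IsScSection f q)
    (hs : B.IsScPlusSection s q) (ht : B.IsScPlusSection t q) (hfs : s q = f q) (hft : t q = f q)
    (hq : M.IsSmoothPoint q) (c : B.ChartAt q) :
    (B.tangentScale c).IsScPlusOperator (B.fiberScale c)
      (B.linearization f s q - B.linearization f t q) := by
  have hF := c.1.R.F.isSc
  -- The derivative of f, which gains no level in general, cancels.
  have key : ∀ v, c.1.fib q ((B.linearization f s q - B.linearization f t q) v) =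
      principalDeriv c t (M.rep c.toBase v) - principalDeriv c s (M.rep c.toBase v) := fun v => by
    have h1 : c.1.fib q (B.linearization f s q v) =
        (principalDeriv c f - principalDeriv c s) (M.rep c.toBase v) := by
      rw [← (principalDeriv_sub hf hs.1 hq c).2]
      exact isLinearization_linearization hf hs.1 hfs hq c v
    have h2 : c.1.fib q (B.linearization f t q v) =
        (principalDeriv c f - principalDeriv c t) (M.rep c.toBase v) := by
      rw [← (principalDeriv_sub hf ht.1 hq c).2]
      exact isLinearization_linearization hf ht.1 hft hq c v
    calc _ = c.1.fib q (B.linearization f s q v) - c.1.fib q (B.linearization f t q v) :=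
          map_sub (c.1.fib q) _ _
      _ = (principalDeriv c f (M.rep c.toBase v) - principalDeriv c s (M.rep c.toBase v)) -
          (principalDeriv c f (M.rep c.toBase v) - principalDeriv c t (M.rep c.toBase v)) := by
        rw [h1, h2]
        rfl
      _ = _ := sub_sub_sub_cancel_left _ _ _
  have hplus : ∀ m, ∃ K, ∀ v ∈ (B.tangentScale c).level m,
      c.1.fib q ((B.linearization f s q - B.linearization f t q) v) ∈
        c.1.R.F.scale.level (m + 1) ∧
      c.1.R.F.scale.nrm (m + 1) (c.1.fib q ((B.linearization f s q - B.linearization f t q) v)) ≤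
        K * (B.tangentScale c).nrm m v := fun m => by
    obtain ⟨K, hK⟩ := hs.exists_bound_principalDeriv hq c m
    obtain ⟨K', hK'⟩ := ht.exists_bound_principalDeriv hq c m
    refine ⟨K' + K, fun v hv => ?_⟩
    obtain ⟨h1, h2⟩ := hK _ hv
    obtain ⟨h3, h4⟩ := hK' _ hv
    rw [key]
    refine ⟨sub_mem h3 h1, (hF.nrm_sub_le h3 h1).trans ?_⟩
    rw [add_mul]
    exact add_le_add h4 h2
  refine ⟨fun m => ?_, hplus⟩
  obtain ⟨K, hK⟩ := hplus m
  obtain ⟨I, hI0, hI⟩ := hF.exists_nrm_le (Nat.le_succ m)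
  refine ⟨I * K, fun v hv => ⟨hF.nested m (hK v hv).1, ?_⟩⟩
  rw [mul_assoc]
  exact (hI _ (hK v hv).1).trans (mul_le_mul_of_nonneg_left (hK v hv).2 hI0)

end StrongBundle

end Bundle

/-! ### Assembly of the three claims -/

theorem mainTheorem5 {X : Type v} [TopologicalSpace X] [T2Space X] [SecondCountableTopology X]
    (M : MPolyfold.{u} X)
    (Y : X → Type w) [∀ x, NormedAddCommGroup (Y x)] [∀ x, NormedSpace ℝ (Y x)]
    [∀ x, CompleteSpace (Y x)]
    [TopologicalSpace (BundleTotal Y)] [T2Space (BundleTotal Y)] [SecondCountableTopology (BundleTotal Y)]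
    (B : StrongBundle.{u} Y M)
    (q : X) (hq : M.IsSmoothPoint q)
    (f : ∀ x, Y x) (hf : B.IsScSection f q) :
    (∀ s : ∀ x, Y x, B.IsScPlusSection s q → s q = f q →
      ∀ L : M.tangentSpace q →ₗ[ℝ] Y q,
        B.IsLinearization f s q L ↔ L = B.linearization f s q) ∧
    ∀ s t : ∀ x, Y x, B.IsScPlusSection s q → B.IsScPlusSection t q →
      s q = f q → t q = f q → ∀ c : B.ChartAt q,
        (B.tangentScale c).IsScPlusOperator (B.fiberScale c)
          (B.linearization f s q - B.linearization f t q) ∧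
        ((B.tangentScale c).IsScFredholm (B.fiberScale c) (B.linearization f s q) →
          (B.tangentScale c).IsScFredholm (B.fiberScale c) (B.linearization f t q) ∧
          fredholmIndex (B.linearization f t q) = fredholmIndex (B.linearization f s q)) := by
  refine ⟨fun s hs hsf L => ⟨fun h =>
      h.unique (StrongBundle.isLinearization_linearization hf hs.1 hsf hq),
    fun h => h ▸ StrongBundle.isLinearization_linearization hf hs.1 hsf hq⟩,
    fun s t hs ht hsf htf c => ?_⟩
  have hplus := StrongBundle.isScPlusOperator_linearization_sub hf hs ht hsf htf hq c
  refine ⟨hplus, fun hfred => ?_⟩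
  have hsplit := hfred
  obtain ⟨-, X', Y', C', hX', hY', -⟩ := hsplit
  -- That the pulled back scales are sc-structures is read off from the sc-splittings contained in
  -- the Fredholm hypothesis.
  have hS : (B.tangentScale c).IsSc :=
    hX'.isSc_of_comap c.1.base.S.isSc_scale (StrongBundle.rep_injective c)
  have hS₂ : (B.fiberScale c).IsSc :=
    hY'.isSc_of_comap c.1.R.F.isSc (c.1.fib_injective c.2.2)
  -- The operator for t is the one for s plus the negative of their sc⁺-difference.
  have h := hfred.add_scPlus hS hS₂ (hplus.neg hS₂)
  rwa [neg_sub, add_sub_cancel] at h
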